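/- All manifolds are real, Hausdorff, second countable and $C^\infty$, and all maps and structures are $C^\infty$. Let $M$ be an $m$-dimensional manifold with a fixed volume form $\eta$, let $\pi\colon E\to M$ be a smooth fibre bundle with $\dim E=m+n$, and let $J^1\pi$ be its first jet bundle with projections $\pi^1\colon J^1\pi\to E$ and $\bar\pi^1=\pi\circ\pi^1\colon J^1\pi\to M$. Sections of $\pi$ and $\bar\pi^1$ are local, that is, defined on open subsets of $M$. A section $\gamma$ is an integral section of a distribution $\mathcal D$ if $T_u\operatorname{Im}(\gamma)=\mathcal D_u$ for all $u\in\operatorname{Im}(\gamma)$. Let $\mathcal L=L\,(\bar\pi^1)^*\eta$, with $L\in C^\infty(J^1\pi)$, be a regular Lagrangian density, meaning that the Hessian $\partial^2L/\partial u^\alpha_i\partial u^\beta_j$ of $L$ along the fibres of $\pi^1$ is nondegenerate everywhere. Let $$\Theta_{\mathcal L}=\frac{\partial L}{\partial u^\alpha_i}\,du^\alpha\wedge d^{m-1}x_i-\Big(\frac{\partial L}{\partial u^\alpha_i}u^\alpha_i-L\Big)d^mx,\qquad \Omega_{\mathcal L}=-d\Theta_{\mathcal L}$$ be its Cartan forms,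 in adapted coordinates with $\eta=d^mx=dx^1\wedge\dots\wedge dx^m$ and $d^{m-1}x_i=i(\partial/\partial x^i)d^mx$. Let $\mathcal D_{\mathcal L}$ be an $m$-dimensional, $\bar\pi^1$-transverse, integrable distribution on $J^1\pi$ whose integral sections are prolongations $j^1\phi$ of sections $\phi$ of $\pi$ satisfying $(j^1\phi)^*\,i(X)\Omega_{\mathcal L}=0$ for every vector field $X$ on $J^1\pi$. For an $m$-dimensional distribution $\mathcal D$ on a manifold, let $\{\mathcal X\}$ be the class of associated multivector fields: the nowhere vanishing, locally decomposable $m$-multivector fields that are sections of $\Lambda^m\mathcal D$. Let $\{\mathcal X_{\mathcal L}\}$ be the class associated with $\mathcal D_{\mathcal L}$. Let $\Psi\colon E\to J^1\pi$ be a jet field (a global section of $\pi^1$), and let $\mathcal D$ be an $m$-dimensional, integrable, $\pi$-transverse distribution on $E$, with associated class $\{\mathcal X\}$. Then the following are equivalent. 1. ($\Psi$ and $\mathcal D$ satisfy the generalized Lagrangian Hamilton–Jacobi condition.) For every section $\gamma$ of $\pi$ that is an integral section of $\mathcal D$, the section $\Psi\circ\gamma$ of $\bar\pi^1$ is an integral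 section of $\mathcal D_{\mathcal L}$; that is, $$T_u\operatorname{Im}(\gamma)=\mathcal D_u\ \ \forall u\in\operatorname{Im}(\gamma)\ \Longrightarrow\ T_{\bar u}\operatorname{Im}(\Psi\circ\gamma)=(\mathcal D_{\mathcal L})_{\bar u}\ \ \forall\bar u\in\operatorname{Im}(\Psi\circ\gamma).$$ 2. ($\mathcal D$ and $\mathcal D_{\mathcal L}$ are $\Psi$-related.) For every $\mathcal X_{\mathcal L}\in\{\mathcal X_{\mathcal L}\}$ there exists $\mathcal X\in\{\mathcal X\}$, and for every $\mathcal X\in\{\mathcal X\}$ there exists $\mathcal X_{\mathcal L}\in\{\mathcal X_{\mathcal L}\}$, such that $\mathcal X_{\mathcal L}\circ\Psi=\Lambda^mT\Psi\circ\mathcal X$. -/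

import Mathlib

open Set Manifold ContDiff

noncomputable section

namespace ClassicalFieldTheory

/-! ### Smooth fibre bundles and their first jet bundles -/

section JetBundle

variable (B EE F : Type*)
  [NormedAddCommGroup B] [NormedSpace ℝ B]
  [NormedAddCommGroup EE] [NormedSpace ℝ EE]
  [NormedAddCommGroup F] [NormedSpace ℝ F]
  (M E S : Type*)
  [TopologicalSpace M] [ChartedSpace B M]
  [TopologicalSpace E] [ChartedSpace EE E]
  [TopologicalSpace S] [ChartedSpace F S]

/-- A smooth fibre bundle `proj : E → M` with typical fibre `S`: a smooth map that is locally,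
over the base, diffeomorphic to the projection of a product. The manifolds `M`, `E`, `S` are
modelled on `B`, `EE`, `F`. -/
structure SmoothFiberBundle where
  proj : E → M
  contMDiff_proj : ContMDiff 𝓘(ℝ, EE) 𝓘(ℝ, B) ∞ proj
  exists_trivialization : ∀ x : M, ∃ t : Bundle.Trivialization S proj, x ∈ t.baseSet ∧
    ContMDiffOn 𝓘(ℝ, EE) (𝓘(ℝ, B).prod 𝓘(ℝ, F)) ∞ t t.source ∧
    ContMDiffOn (𝓘(ℝ, B).prod 𝓘(ℝ, F)) 𝓘(ℝ, EE) ∞ t.toOpenPartialHomeomorph.symm t.target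

variable {B EE F M E S}

/-- A `1`-jet at `x = π u` of a local section `φ` of `π` with `φ x = u`, recorded as the point
`u` together with the tangent map `T_x φ : T_x M → T_u E`; the linear maps that arise in this way
are the right inverses of `T_u π`. -/
@[ext]
structure Jet (p : SmoothFiberBundle B EE F M E S) where
  pt : E
  lin : TangentSpace 𝓘(ℝ, B) (p.proj pt) →L[ℝ] TangentSpace 𝓘(ℝ, EE) pt
  proj_lin : (mfderiv 𝓘(ℝ, EE) 𝓘(ℝ, B) p.proj pt).comp lin = ContinuousLinearMap.id ℝ _

/-- Local coordinates `(xⁱ)` of `M` and adapted local coordinates `(xⁱ, u^α)` of `E`. -/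
structure AdaptedChart (p : SmoothFiberBundle B EE F M E S) where
  base : OpenPartialHomeomorph M B
  tot : OpenPartialHomeomorph E (B × F)
  contMDiffOn_base : ContMDiffOn 𝓘(ℝ, B) 𝓘(ℝ, B) ∞ base base.source
  contMDiffOn_base_symm : ContMDiffOn 𝓘(ℝ, B) 𝓘(ℝ, B) ∞ base.symm base.target
  contMDiffOn_tot : ContMDiffOn 𝓘(ℝ, EE) 𝓘(ℝ, B × F) ∞ tot tot.source
  contMDiffOn_tot_symm : ContMDiffOn 𝓘(ℝ, B × F) 𝓘(ℝ, EE) ∞ tot.symm tot.target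
  proj_mem : ∀ u ∈ tot.source, p.proj u ∈ base.source
  fst_tot : ∀ u ∈ tot.source, (tot u).1 = base (p.proj u)
  nonempty : tot.source.Nonempty

namespace AdaptedChart

variable {p : SmoothFiberBundle B EE F M E S} (c c' : AdaptedChart p)

/-- The differential of the coordinates `(xⁱ, u^α)` at a point of `E`. -/
def dTot (u : E) : TangentSpace 𝓘(ℝ, EE) u →L[ℝ] B × F :=
  (NormedSpace.fromTangentSpace (𝕜 := ℝ) (c.tot u)).toContinuousLinearMap.comp
    (mfderiv 𝓘(ℝ, EE) 𝓘(ℝ, B × F) c.tot u)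

/-- The differential of the coordinates `(xⁱ)` at a point of `M`. -/
def dBase (x : M) : TangentSpace 𝓘(ℝ, B) x →L[ℝ] B :=
  (NormedSpace.fromTangentSpace (𝕜 := ℝ) (c.base x)).toContinuousLinearMap.comp
    (mfderiv 𝓘(ℝ, B) 𝓘(ℝ, B) c.base x)

theorem mdifferentiable_tot : c.tot.MDifferentiable 𝓘(ℝ, EE) 𝓘(ℝ, B × F) :=
  ⟨c.contMDiffOn_tot.mdifferentiableOn (by simp), c.contMDiffOn_tot_symm.mdifferentiableOn (by simp)⟩

theorem mdifferentiable_base : c.base.MDifferentiable 𝓘(ℝ, B) 𝓘(ℝ, B) :=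
  ⟨c.contMDiffOn_base.mdifferentiableOn (by simp),
    c.contMDiffOn_base_symm.mdifferentiableOn (by simp)⟩

theorem isInvertible_dTot {u : E} (hu : u ∈ c.tot.source) : (c.dTot u).IsInvertible :=
  ⟨(c.mdifferentiable_tot.mfderiv hu).trans (NormedSpace.fromTangentSpace (𝕜 := ℝ) (c.tot u)), rfl⟩

theorem isInvertible_dBase {x : M} (hx : x ∈ c.base.source) : (c.dBase x).IsInvertible :=
  ⟨(c.mdifferentiable_base.mfderiv hx).trans (NormedSpace.fromTangentSpace (𝕜 := ℝ) (c.base x)),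
    rfl⟩

theorem hasMFDerivAt_tot {u : E} (hu : u ∈ c.tot.source) :
    HasMFDerivAt 𝓘(ℝ, EE) 𝓘(ℝ, B × F) c.tot u (c.dTot u) :=
  (c.mdifferentiable_tot.mdifferentiableAt hu).hasMFDerivAt

theorem hasMFDerivAt_base {x : M} (hx : x ∈ c.base.source) :
    HasMFDerivAt 𝓘(ℝ, B) 𝓘(ℝ, B) c.base x (c.dBase x) :=
  (c.mdifferentiable_base.mdifferentiableAt hx).hasMFDerivAt

/-- The adapted coordinates intertwine `T π` with the projection `B × F → B`. -/
theorem fst_comp_dTot {u : E} (hu : u ∈ c.tot.source) :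
    (ContinuousLinearMap.fst ℝ B F).comp (c.dTot u) =
      (c.dBase (p.proj u)).comp (mfderiv 𝓘(ℝ, EE) 𝓘(ℝ, B) p.proj u) := by
  have h1 : HasMFDerivAt 𝓘(ℝ, EE) 𝓘(ℝ, B) (fun v => (c.tot v).1) u
      ((ContinuousLinearMap.fst ℝ B F).comp (c.dTot u)) :=
    HasMFDerivAt.comp u
      ((ContinuousLinearMap.fst ℝ B F).hasFDerivAt.hasMFDerivAt (x := c.tot u))
      (c.hasMFDerivAt_tot hu)
  have h2 : HasMFDerivAt 𝓘(ℝ, EE) 𝓘(ℝ, B) (fun v => c.base (p.proj v)) u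
      ((c.dBase (p.proj u)).comp (mfderiv 𝓘(ℝ, EE) 𝓘(ℝ, B) p.proj u)) :=
    HasMFDerivAt.comp u (c.hasMFDerivAt_base (c.proj_mem u hu))
      ((p.contMDiff_proj.mdifferentiable (by simp)) u).hasMFDerivAt
  have h3 : (fun v => (c.tot v).1) =ᶠ[nhds u] (fun v => c.base (p.proj v)) :=
    Filter.eventuallyEq_of_mem (c.tot.open_source.mem_nhds hu) c.fst_tot
  exact hasMFDerivAt_unique h1 (h2.congr_of_eventuallyEq h3)

/-- The jet at `u` with coordinates `u_i^α` given by `q`. -/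
def mkJet (u : E) (hu : u ∈ c.tot.source) (q : B →L[ℝ] F) : Jet p where
  pt := u
  lin := (c.dTot u).inverse.comp (((ContinuousLinearMap.id ℝ B).prod q).comp (c.dBase (p.proj u)))
  proj_lin := by
    have hb := c.isInvertible_dBase (c.proj_mem u hu)
    have ht := c.isInvertible_dTot hu
    ext v
    apply hb.injective
    have := DFunLike.congr_fun (c.fst_comp_dTot hu)
      ((c.dTot u).inverse (c.dBase (p.proj u) v, q (c.dBase (p.proj u) v)))
    simp only [ContinuousLinearMap.comp_apply, ht.self_apply_inverse] at this
    simpa using this.symm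

open Classical in
/-- The inverse of the coordinates `(xⁱ, u^α, u_i^α)` of the jet bundle (with a junk value outside
the range of the coordinates). -/
def jetChartInv (y : (B × F) × (B →L[ℝ] F)) : Jet p :=
  if h : y.1 ∈ c.tot.target then c.mkJet (c.tot.symm y.1) (c.tot.map_target h) y.2
  else c.mkJet c.nonempty.some c.nonempty.some_mem 0

theorem jetChartInv_eq {y : (B × F) × (B →L[ℝ] F)} (h : y.1 ∈ c.tot.target) :
    c.jetChartInv y = c.mkJet (c.tot.symm y.1) (c.tot.map_target h) y.2 := dif_pos h

/-- The chart `(xⁱ, u^α, u_i^α)` of the jet bundle induced by an adapted chart: a `1`-jet `T_x φ`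
is sent to the coordinates of its point and the derivative in coordinates of `u^α ∘ φ`. -/
def jetChart : PartialEquiv (Jet p) ((B × F) × (B →L[ℝ] F)) where
  toFun j := (c.tot j.pt, (ContinuousLinearMap.snd ℝ B F).comp
    ((c.dTot j.pt).comp (j.lin.comp (c.dBase (p.proj j.pt)).inverse)))
  invFun := c.jetChartInv
  source := {j | j.pt ∈ c.tot.source}
  target := c.tot.target ×ˢ univ
  map_source' j hj := ⟨c.tot.map_source hj, mem_univ _⟩
  map_target' y hy := by
    change (c.jetChartInv y).pt ∈ c.tot.source
    rw [c.jetChartInv_eq hy.1]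
    exact c.tot.map_target hy.1
  left_inv' j hj := by
    obtain ⟨u, h, hP⟩ := j
    change u ∈ c.tot.source at hj
    rw [c.jetChartInv_eq (c.tot.map_source hj)]
    have key : ∀ (w : E) (hw : w ∈ c.tot.source), w = u → ∀ q : B →L[ℝ] F,
        q = (ContinuousLinearMap.snd ℝ B F).comp
          ((c.dTot u).comp (h.comp (c.dBase (p.proj u)).inverse)) →
        c.mkJet w hw q = ⟨u, h, hP⟩ := by
      rintro w hw rfl q rfl
      have hb := c.isInvertible_dBase (c.proj_mem w hw)
      have ht := c.isInvertible_dTot hw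
      simp only [mkJet, Jet.mk.injEq, true_and]
      ext v
      apply ht.injective
      simp only [ContinuousLinearMap.comp_apply, ht.self_apply_inverse,
        ContinuousLinearMap.prod_apply, ContinuousLinearMap.id_apply, hb.inverse_apply_self]
      have h1 := DFunLike.congr_fun (c.fst_comp_dTot hw) (h v)
      have h2 := DFunLike.congr_fun hP v
      simp only [ContinuousLinearMap.comp_apply, ContinuousLinearMap.id_apply] at h1 h2
      rw [h2] at h1
      exact Prod.ext h1.symm rfl
    exact key _ _ (c.tot.left_inv hj) _ rfl
  right_inv' y hy := by
    obtain ⟨y, q⟩ := y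
    have h := hy.1
    change y ∈ c.tot.target at h
    rw [c.jetChartInv_eq (y := (y, q)) h]
    have hu := c.tot.map_target h
    have hb := c.isInvertible_dBase (c.proj_mem _ hu)
    have ht := c.isInvertible_dTot hu
    refine Prod.ext (c.tot.right_inv h) ?_
    ext v
    have h1 := hb.self_apply_inverse v
    have h2 := ht.self_apply_inverse (v, q v)
    rw [← h1] at h2
    exact (congrArg Prod.snd h2).trans (by rw [h1])

theorem proj_dTot_inverse {u : E} (hu : u ∈ c.tot.source) (q : B →L[ℝ] F) (v : B) :
    mfderiv 𝓘(ℝ, EE) 𝓘(ℝ, B) p.proj u ((c.dTot u).inverse (v, q v)) =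
      (c.dBase (p.proj u)).inverse v := by
  have h := DFunLike.congr_fun (c.mkJet u hu q).proj_lin ((c.dBase (p.proj u)).inverse v)
  change mfderiv 𝓘(ℝ, EE) 𝓘(ℝ, B) p.proj u ((c.dTot u).inverse
    (c.dBase (p.proj u) ((c.dBase (p.proj u)).inverse v),
      q (c.dBase (p.proj u) ((c.dBase (p.proj u)).inverse v)))) = _ at h
  rwa [(c.isInvertible_dBase (c.proj_mem u hu)).self_apply_inverse] at h

/-- The change of adapted coordinates on `E`. -/
def trans (y : B × F) : B × F := c'.tot (c.tot.symm y)

/-- The domain of the change of adapted coordinates on `E`. -/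
def overlap : Set (B × F) := c.tot.target ∩ c.tot.symm ⁻¹' c'.tot.source

theorem isOpen_overlap : IsOpen (c.overlap c') := (c.tot.symm.trans c'.tot).open_source

theorem contDiffOn_trans :
    ContDiffOn ℝ ∞ (c.trans c') (c.overlap c') := by
  rw [← contMDiffOn_iff_contDiffOn]
  exact c'.contMDiffOn_tot.comp (c.contMDiffOn_tot_symm.mono fun y hy => hy.1) fun y hy => hy.2

theorem fderiv_trans {y : B × F} (hy : y ∈ c.overlap c') :
    fderiv ℝ (c.trans c') y =
      (c'.dTot (c.tot.symm y)).comp (c.dTot (c.tot.symm y)).inverse := by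
  have hu : c.tot.symm y ∈ c.tot.source := c.tot.map_target hy.1
  have h1 : DifferentiableAt ℝ (c.trans c') y :=
    ((c.contDiffOn_trans c').differentiableOn (by simp)).differentiableAt
      ((c.isOpen_overlap c').mem_nhds hy)
  have h2 : DifferentiableAt ℝ (c.trans c') (c.tot (c.tot.symm y)) := by
    rwa [c.tot.right_inv hy.1]
  have h3 : HasMFDerivAt 𝓘(ℝ, EE) 𝓘(ℝ, B × F) (c.trans c' ∘ c.tot) (c.tot.symm y)
      ((fderiv ℝ (c.trans c') (c.tot (c.tot.symm y))).comp (c.dTot (c.tot.symm y))) :=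
    HasMFDerivAt.comp _ h2.hasFDerivAt.hasMFDerivAt (c.hasMFDerivAt_tot hu)
  have h4 : c'.tot =ᶠ[nhds (c.tot.symm y)] c.trans c' ∘ c.tot :=
    Filter.eventuallyEq_of_mem (c.tot.open_source.mem_nhds hu) fun v hv => by
      simp [trans, c.tot.left_inv hv]
  have h5 := hasMFDerivAt_unique (c'.hasMFDerivAt_tot hy.2) (h3.congr_of_eventuallyEq h4)
  rw [c.tot.right_inv hy.1] at h5
  refine ContinuousLinearMap.ext fun v => ?_
  have h6 := DFunLike.congr_fun h5 ((c.dTot (c.tot.symm y)).inverse v)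
  rw [ContinuousLinearMap.comp_apply]
  refine Eq.trans ?_ h6.symm
  exact congrArg _ ((c.isInvertible_dTot hu).self_apply_inverse v).symm

theorem jetChart_trans_source :
    (c.jetChart.symm.trans c'.jetChart).source = (c.overlap c') ×ˢ univ := by
  ext ⟨y, q⟩
  simp only [PartialEquiv.trans_source, PartialEquiv.symm_source, mem_inter_iff, mem_preimage,
    mem_prod, mem_univ, and_true, overlap]
  have h0 : (y, q) ∈ c.jetChart.target ↔ y ∈ c.tot.target := by simp [jetChart]
  rw [h0]
  refine and_congr_right fun h => ?_
  change (c.jetChartInv (y, q)).pt ∈ c'.tot.source ↔ _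
  rw [c.jetChartInv_eq (y := (y, q)) h]
  rfl

/-- The matrix of the tangent map of a section, in the new coordinates. -/
def transLin (z : (B × F) × (B →L[ℝ] F)) : B →L[ℝ] B × F :=
  (fderiv ℝ (c.trans c') z.1).comp ((ContinuousLinearMap.id ℝ B).prod z.2)

theorem fst_transLin {z : (B × F) × (B →L[ℝ] F)}
    (hz : z.1 ∈ c.overlap c') :
    (ContinuousLinearMap.fst ℝ B F).comp (c.transLin c' z) =
      (c'.dBase (p.proj (c.tot.symm z.1))).comp (c.dBase (p.proj (c.tot.symm z.1))).inverse := by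
  have hu : c.tot.symm z.1 ∈ c.tot.source := c.tot.map_target hz.1
  have hb := c.isInvertible_dBase (c.proj_mem _ hu)
  rw [transLin, fderiv_trans c c' hz]
  ext v
  have h1 := DFunLike.congr_fun (c'.fst_comp_dTot hz.2)
    ((c.dTot (c.tot.symm z.1)).inverse (v, z.2 v))
  exact h1.trans (congrArg _ (c.proj_dTot_inverse hu z.2 v))

theorem jetChart_trans_eq {z : (B × F) × (B →L[ℝ] F)}
    (hz : z.1 ∈ c.overlap c') :
    c'.jetChart (c.jetChart.symm z) = (c.trans c' z.1, (ContinuousLinearMap.snd ℝ B F).comp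
      ((c.transLin c' z).comp
        ((ContinuousLinearMap.fst ℝ B F).comp (c.transLin c' z)).inverse)) := by
  have hu : c.tot.symm z.1 ∈ c.tot.source := c.tot.map_target hz.1
  have hb := c.isInvertible_dBase (c.proj_mem _ hu)
  have hb' := c'.isInvertible_dBase (c'.proj_mem _ hz.2)
  rw [fst_transLin c c' hz, hb'.inverse_comp_of_left, hb.inverse_inverse, transLin,
    fderiv_trans c c' hz]
  have h : z.1 ∈ c.tot.target := hz.1
  change c'.jetChart (c.jetChartInv z) = _
  rw [c.jetChartInv_eq h]
  rfl

theorem isInvertible_fst_transLin {z : (B × F) × (B →L[ℝ] F)}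
    (hz : z.1 ∈ c.overlap c') :
    ((ContinuousLinearMap.fst ℝ B F).comp (c.transLin c' z)).IsInvertible := by
  rw [fst_transLin c c' hz]
  exact (c'.isInvertible_dBase (c'.proj_mem _ hz.2)).comp
    (c.isInvertible_dBase (c.proj_mem _ (c.tot.map_target hz.1))).inverse

theorem contDiffOn_jetChart_trans [CompleteSpace B] :
    ContDiffOn ℝ ∞ (c.jetChart.symm.trans c'.jetChart)
      (c.jetChart.symm.trans c'.jetChart).source := by
  rw [jetChart_trans_source]
  have ho := c.isOpen_overlap c'
  have hT := c.contDiffOn_trans c'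
  have hfst : MapsTo (Prod.fst : (B × F) × (B →L[ℝ] F) → B × F)
      ((c.overlap c') ×ˢ univ) (c.overlap c') :=
    fun z hz => hz.1
  have hD : ContDiffOn ℝ ∞ (c.transLin c') ((c.overlap c') ×ˢ univ) := by
    refine ContDiffOn.clm_comp ((hT.fderiv_of_isOpen ho (m := ∞) (by simp)).comp
      contDiff_fst.contDiffOn hfst) ?_
    have : ContDiff ℝ ∞ fun z : (B × F) × (B →L[ℝ] F) =>
        (ContinuousLinearMap.inl ℝ B F) + (ContinuousLinearMap.inr ℝ B F).comp z.2 :=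
      contDiff_const.add (contDiff_const.clm_comp contDiff_snd)
    refine this.contDiffOn.congr fun z _ => ?_
    ext v <;> simp
  have hI : ContDiffOn ℝ ∞
      (fun z => ((ContinuousLinearMap.fst ℝ B F).comp (c.transLin c' z)).inverse)
      ((c.overlap c') ×ˢ univ) := fun z hz =>
    ((c.isInvertible_fst_transLin c' hz.1).contDiffAt_map_inverse).comp_contDiffWithinAt
      (f := fun z => (ContinuousLinearMap.fst ℝ B F).comp (c.transLin c' z)) z
      ((contDiffOn_const.clm_comp hD) z hz)
  have hS : ContDiffOn ℝ ∞ (fun _ => ContinuousLinearMap.snd ℝ B F) (c.overlap c' ×ˢ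
      (univ : Set (B →L[ℝ] F))) := contDiffOn_const
  refine ContDiffOn.congr ((hT.comp contDiff_fst.contDiffOn hfst).prodMk
    (hS.clm_comp (hD.clm_comp hI))) fun z hz => ?_
  exact c.jetChart_trans_eq c' hz.1

/-- Adapted coordinates exist around every point. -/
theorem exists_mem [IsManifold 𝓘(ℝ, B) ∞ M] [IsManifold 𝓘(ℝ, F) ∞ S]
    (p : SmoothFiberBundle B EE F M E S) (u : E) : ∃ c : AdaptedChart p, u ∈ c.tot.source := by
  obtain ⟨t, hx, ht, ht'⟩ := p.exists_trivialization (p.proj u)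
  have hu : u ∈ t.source := by rwa [t.mem_source]
  let φ := chartAt B (p.proj u)
  let ψ := chartAt F (t u).2
  have hpr : ∀ v ∈ t.source, (t v).1 = p.proj v := fun v hv => t.coe_fst hv
  have hφ := contMDiffOn_chart (I := 𝓘(ℝ, B)) (n := ∞) (x := p.proj u)
  have hφ' := contMDiffOn_chart_symm (I := 𝓘(ℝ, B)) (n := ∞) (x := p.proj u)
  have hψ := contMDiffOn_chart (I := 𝓘(ℝ, F)) (n := ∞) (x := (t u).2)
  have hψ' := contMDiffOn_chart_symm (I := 𝓘(ℝ, F)) (n := ∞) (x := (t u).2)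
  refine ⟨{ base := φ
            tot := t.toOpenPartialHomeomorph.trans (φ.prod ψ)
            contMDiffOn_base := hφ
            contMDiffOn_base_symm := hφ'
            contMDiffOn_tot := ?_
            contMDiffOn_tot_symm := ?_
            proj_mem := ?_
            fst_tot := ?_
            nonempty := ⟨u, ?_⟩ }, ?_⟩
  · have h1 : ContMDiffOn 𝓘(ℝ, EE) 𝓘(ℝ, B) ∞ (fun v => φ (t v).1)
        (t.toOpenPartialHomeomorph.trans (φ.prod ψ)).source :=
      hφ.comp (contMDiff_fst.comp_contMDiffOn (ht.mono fun v hv => hv.1)) fun v hv => hv.2.1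
    have h2 : ContMDiffOn 𝓘(ℝ, EE) 𝓘(ℝ, F) ∞ (fun v => ψ (t v).2)
        (t.toOpenPartialHomeomorph.trans (φ.prod ψ)).source :=
      hψ.comp (contMDiff_snd.comp_contMDiffOn (ht.mono fun v hv => hv.1)) fun v hv => hv.2.2
    exact h1.prodMk_space h2
  · have h1 : ContMDiffOn 𝓘(ℝ, B × F) 𝓘(ℝ, B) ∞ (fun y : B × F => φ.symm y.1)
        (t.toOpenPartialHomeomorph.trans (φ.prod ψ)).target :=
      hφ'.comp contDiff_fst.contMDiff.contMDiffOn fun y hy => hy.1.1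
    have h2 : ContMDiffOn 𝓘(ℝ, B × F) 𝓘(ℝ, F) ∞ (fun y : B × F => ψ.symm y.2)
        (t.toOpenPartialHomeomorph.trans (φ.prod ψ)).target :=
      hψ'.comp contDiff_snd.contMDiff.contMDiffOn fun y hy => hy.1.2
    exact ht'.comp (h1.prodMk h2) fun y hy => hy.2
  · intro v hv
    rw [← hpr v hv.1]
    exact hv.2.1
  · intro v hv
    change φ (t v).1 = _
    rw [hpr v hv.1]
  all_goals
    refine ⟨hu, ?_, mem_chart_source F _⟩
    change (t u).1 ∈ φ.source
    rw [hpr u hu]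
    exact mem_chart_source B _

end AdaptedChart

namespace Jet

variable [CompleteSpace B] [IsManifold 𝓘(ℝ, B) ∞ M] [IsManifold 𝓘(ℝ, F) ∞ S]
  (p : SmoothFiberBundle B EE F M E S)

/-- The manifold structure of the jet bundle is the one given by all the charts
`(xⁱ, u^α, u_i^α)` induced by adapted charts. -/
def chartedSpaceCore : ChartedSpaceCore ((B × F) × (B →L[ℝ] F)) (Jet p) where
  atlas := range AdaptedChart.jetChart
  chartAt j := (AdaptedChart.exists_mem p j.pt).choose.jetChart
  mem_chart_source j := (AdaptedChart.exists_mem p j.pt).choose_spec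
  chart_mem_atlas j := mem_range_self _
  open_source := by
    rintro _ _ ⟨c, rfl⟩ ⟨c', rfl⟩
    rw [AdaptedChart.jetChart_trans_source]
    exact (c.isOpen_overlap c').prod isOpen_univ
  continuousOn_toFun := by
    rintro _ _ ⟨c, rfl⟩ ⟨c', rfl⟩
    exact (c.contDiffOn_jetChart_trans c').continuousOn

instance : TopologicalSpace (Jet p) := (chartedSpaceCore p).toTopologicalSpace

instance : ChartedSpace ((B × F) × (B →L[ℝ] F)) (Jet p) := (chartedSpaceCore p).toChartedSpace

instance : IsManifold 𝓘(ℝ, (B × F) × (B →L[ℝ] F)) ∞ (Jet p) := by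
  apply isManifold_of_contDiffOn
  intro e e' he he'
  obtain ⟨_, ⟨c, rfl⟩, rfl⟩ := mem_iUnion₂.1 he
  obtain ⟨_, ⟨c', rfl⟩, rfl⟩ := mem_iUnion₂.1 he'
  exact (c.contDiffOn_jetChart_trans c').mono inter_subset_left

end Jet

end JetBundle

/-! ### Multilinear algebra -/

section Algebra

variable {V W : Type*}
  [AddCommGroup V] [Module ℝ V] [TopologicalSpace V] [IsTopologicalAddGroup V] [ContinuousSMul ℝ V]
  [AddCommGroup W] [Module ℝ W] [TopologicalSpace W]

/-- Alternating forms on a finite-dimensional space are continuous. -/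
def alternatingMapToContinuous [T2Space V] [FiniteDimensional ℝ V] {k : ℕ}
    (f : V [⋀^Fin k]→ₗ[ℝ] ℝ) : V [⋀^Fin k]→L[ℝ] ℝ :=
  { f with
    cont := by
      let b := Module.finBasis ℝ V
      have h : (fun v : Fin k → V => f v) = fun v => ∑ r : Fin k → Fin (Module.finrank ℝ V),
          (∏ i, b.coord (r i) (v i)) * f (fun i => b (r i)) := by
        funext v
        have hv : v = fun i => ∑ l, b.coord l (v i) • b l := by
          funext i
          simp [b.sum_repr (v i)]
        conv_lhs => rw [hv]
        change f.toMultilinearMap _ = _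
        rw [MultilinearMap.map_sum]
        refine Finset.sum_congr rfl fun r _ => ?_
        rw [MultilinearMap.map_smul_univ]
        rfl
      change Continuous fun v : Fin k → V => f v
      rw [h]
      refine continuous_finsetSum _ fun r _ => Continuous.mul ?_ continuous_const
      exact continuous_finsetProd _ fun i _ =>
        ((b.coord (r i)).continuous_of_finiteDimensional).comp (continuous_apply i) }

/-- For an alternating form `θ` on `W`, a linear map `P : V → W` and a bilinear map
`β : W* × V → ℝ`, the alternating form
`(v₁, …, v_k) ↦ ∑ᵢ β (w ↦ θ (P v₁, …, w, …, P v_k)) vᵢ` on `V`, with `w` in the `i`-th place. -/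
def slotSum {k : ℕ} (θ : W [⋀^Fin k]→L[ℝ] ℝ) (P : V →L[ℝ] W)
    (β : (W →L[ℝ] ℝ) →ₗ[ℝ] V →ₗ[ℝ] ℝ) : V [⋀^Fin k]→ₗ[ℝ] ℝ where
  toFun v := ∑ i, β (θ.toContinuousLinearMap (fun l => P (v l)) i) (v i)
  map_update_add' := by
    intro inst v i x y
    obtain rfl : inst = instDecidableEqFin k := Subsingleton.elim _ _
    rw [← Finset.sum_add_distrib]
    refine Finset.sum_congr rfl fun l _ => ?_
    have hP : ∀ z, (fun l => P (Function.update v i z l)) =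
        Function.update (fun l => P (v l)) i (P z) := fun z => Function.comp_update P v i z
    simp only [hP]
    by_cases hl : l = i
    · subst hl
      have h : ∀ z, θ.toContinuousLinearMap (Function.update (fun l => P (v l)) l z) l =
          θ.toContinuousLinearMap (fun l => P (v l)) l := fun z => by
        ext w
        simp [ContinuousAlternatingMap.toContinuousLinearMap]
      simp only [h, Function.update_self, map_add]
    · have h : θ.toContinuousLinearMap (Function.update (fun l => P (v l)) i (P (x + y))) l =
          θ.toContinuousLinearMap (Function.update (fun l => P (v l)) i (P x)) l +
          θ.toContinuousLinearMap (Function.update (fun l => P (v l)) i (P y)) l := by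
        ext w
        simp only [ContinuousAlternatingMap.toContinuousLinearMap_apply, add_apply,
          Function.update_comm (Ne.symm hl), map_add, ContinuousAlternatingMap.map_update_add]
      rw [h]
      simp [Function.update_of_ne hl]
  map_update_smul' := by
    intro inst v i a x
    obtain rfl : inst = instDecidableEqFin k := Subsingleton.elim _ _
    rw [smul_eq_mul, Finset.mul_sum]
    refine Finset.sum_congr rfl fun l _ => ?_
    have hP : ∀ z, (fun l => P (Function.update v i z l)) =
        Function.update (fun l => P (v l)) i (P z) := fun z => Function.comp_update P v i z
    simp only [hP]
    by_cases hl : l = i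
    · subst hl
      have h : ∀ z, θ.toContinuousLinearMap (Function.update (fun l => P (v l)) l z) l =
          θ.toContinuousLinearMap (fun l => P (v l)) l := fun z => by
        ext w
        simp [ContinuousAlternatingMap.toContinuousLinearMap]
      simp only [h, Function.update_self, map_smul, smul_eq_mul]
    · have h : θ.toContinuousLinearMap (Function.update (fun l => P (v l)) i (P (a • x))) l =
          a • θ.toContinuousLinearMap (Function.update (fun l => P (v l)) i (P x)) l := by
        ext w
        simp only [ContinuousAlternatingMap.toContinuousLinearMap_apply, smul_apply,
          Function.update_comm (Ne.symm hl), map_smul, ContinuousAlternatingMap.map_update_smul]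
      rw [h]
      simp [Function.update_of_ne hl]
  map_eq_zero_of_eq' := by
    intro v i j hv hij
    have h0 : ∀ l, l ≠ i → l ≠ j → θ.toContinuousLinearMap (fun l => P (v l)) l = 0 := by
      intro l hi hj
      ext w
      refine θ.map_eq_zero_of_eq _ (i := i) (j := j) ?_ hij
      simp [Function.update_of_ne hi.symm, Function.update_of_ne hj.symm, hv]
    have h1 : θ.toContinuousLinearMap (fun l => P (v l)) j =
        -θ.toContinuousLinearMap (fun l => P (v l)) i := by
      ext w
      have h2 : Function.update (fun l => P (v l)) j w =
          Function.update (fun l => P (v l)) i w ∘ Equiv.swap i j := by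
        funext l
        rcases eq_or_ne l i with rfl | hi
        · simp [Function.update_of_ne hij, Function.update_of_ne hij.symm, hv]
        · rcases eq_or_ne l j with rfl | hj
          · simp
          · simp [Function.update_of_ne hi, Function.update_of_ne hj,
              Equiv.swap_apply_of_ne_of_ne hi hj]
      change θ (Function.update (fun l => P (v l)) j w) = -θ (Function.update (fun l => P (v l)) i w)
      rw [h2]
      exact θ.toAlternatingMap.map_swap _ hij
    rw [Finset.sum_eq_add i j hij (fun l _ hl => by simp [h0 l hl.1 hl.2]) (by simp) (by simp),
      h1, hv]
    simp

end Algebra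

/-! ### Differential forms, distributions and multivector fields on a manifold -/

section Manifolds

variable {V N : Type*} [NormedAddCommGroup V] [NormedSpace ℝ V] [TopologicalSpace N]
  [ChartedSpace V N]

/-- The local expression of a `k`-form in the chart around `x₀`. -/
def formInChart {k : ℕ} (θ : ∀ x : N, TangentSpace 𝓘(ℝ, V) x [⋀^Fin k]→L[ℝ] ℝ) (x₀ : N) (y : V) :
    V [⋀^Fin k]→L[ℝ] ℝ :=
  (θ ((chartAt V x₀).symm y)).compContinuousLinearMap
    ((mfderiv 𝓘(ℝ, V) 𝓘(ℝ, V) (chartAt V x₀).symm y).comp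
      (NormedSpace.fromTangentSpace (𝕜 := ℝ) y).symm.toContinuousLinearMap)

/-- A `k`-form is smooth if its local expressions are. -/
def IsSmoothForm {k : ℕ} (θ : ∀ x : N, TangentSpace 𝓘(ℝ, V) x [⋀^Fin k]→L[ℝ] ℝ) : Prop :=
  ∀ x₀ : N, ContDiffOn ℝ ∞ (formInChart θ x₀) (chartAt V x₀).target

/-- The exterior derivative of a `k`-form, computed at `x` in the chart around `x`. -/
def formExtDeriv {k : ℕ} (θ : ∀ x : N, TangentSpace 𝓘(ℝ, V) x [⋀^Fin k]→L[ℝ] ℝ) (x : N) :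
    TangentSpace 𝓘(ℝ, V) x [⋀^Fin (k + 1)]→L[ℝ] ℝ :=
  (extDeriv (formInChart θ x) (chartAt V x x)).compContinuousLinearMap
    ((NormedSpace.fromTangentSpace (𝕜 := ℝ) (chartAt V x x)).toContinuousLinearMap.comp
      (mfderiv 𝓘(ℝ, V) 𝓘(ℝ, V) (chartAt V x) x))

/-- A volume form on a manifold (of dimension `k`): a smooth nowhere vanishing `k`-form. -/
structure IsVolumeForm {k : ℕ} (θ : ∀ x : N, TangentSpace 𝓘(ℝ, V) x [⋀^Fin k]→L[ℝ] ℝ) :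
    Prop where
  smooth : IsSmoothForm θ
  ne_zero : ∀ x, θ x ≠ 0

variable [IsManifold 𝓘(ℝ, V) ∞ N]

/-- The vector field `X` is smooth on `U`. -/
def IsSmoothVectorFieldOn (X : ∀ x : N, TangentSpace 𝓘(ℝ, V) x) (U : Set N) : Prop :=
  ContMDiffOn 𝓘(ℝ, V) 𝓘(ℝ, V).tangent ∞ (fun x => (⟨x, X x⟩ : TangentBundle 𝓘(ℝ, V) N)) U

variable (V N) in
/-- A `k`-dimensional (smooth) distribution: a subbundle of rank `k` of the tangent bundle. -/
structure TangentDistribution (k : ℕ) where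
  space : ∀ x : N, Submodule ℝ (TangentSpace 𝓘(ℝ, V) x)
  exists_frame : ∀ x₀ : N, ∃ U : Set N, IsOpen U ∧ x₀ ∈ U ∧
    ∃ X : Fin k → ∀ x : N, TangentSpace 𝓘(ℝ, V) x, (∀ i, IsSmoothVectorFieldOn (X i) U) ∧
      ∀ x ∈ U, LinearIndependent ℝ (fun i => X i x) ∧
        Submodule.span ℝ (range fun i => X i x) = space x

/-- A multivector field `X` of degree `k` is locally decomposable if around every point it is
`X₁ ∧ ⋯ ∧ X_k` for smooth vector fields `X₁, …, X_k` (in particular it is smooth). -/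
def IsLocallyDecomposable {k : ℕ} (X : ∀ x : N, ⋀[ℝ]^k (TangentSpace 𝓘(ℝ, V) x)) : Prop :=
  ∀ x₀ : N, ∃ U : Set N, IsOpen U ∧ x₀ ∈ U ∧
    ∃ Y : Fin k → ∀ x : N, TangentSpace 𝓘(ℝ, V) x, (∀ i, IsSmoothVectorFieldOn (Y i) U) ∧
      ∀ x ∈ U, X x = exteriorPower.ιMulti ℝ k fun i => Y i x

namespace TangentDistribution

/-- `D` is integrable: through every point passes an integral manifold of `D`, that is, an immersed
`k`-dimensional submanifold (locally parametrized by an open subset of `ℝ^k`) whose tangent spaces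
are the spaces of `D`. -/
def IsIntegrable {k : ℕ} (D : TangentDistribution V N k) : Prop :=
  ∀ x : N, ∃ (U : Set (EuclideanSpace ℝ (Fin k))) (f : EuclideanSpace ℝ (Fin k) → N),
    IsOpen U ∧ 0 ∈ U ∧ f 0 = x ∧ ContMDiffOn 𝓘(ℝ, EuclideanSpace ℝ (Fin k)) 𝓘(ℝ, V) ∞ f U ∧
    ∀ t ∈ U, Function.Injective (mfderiv 𝓘(ℝ, EuclideanSpace ℝ (Fin k)) 𝓘(ℝ, V) f t) ∧
      (mfderiv 𝓘(ℝ, EuclideanSpace ℝ (Fin k)) 𝓘(ℝ, V) f t).range = D.space (f t)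

/-- The equivalence class `{X}` of multivector fields associated with the distribution `D`: the
nowhere vanishing, locally decomposable `k`-multivector fields that are sections of `Λ^k D`. -/
def multivectorClass {k : ℕ} (D : TangentDistribution V N k) :
    Set (∀ x : N, ⋀[ℝ]^k (TangentSpace 𝓘(ℝ, V) x)) :=
  {X | (∀ x, X x ≠ 0) ∧ IsLocallyDecomposable X ∧
    ∀ x, X x ∈ LinearMap.range (exteriorPower.map k (D.space x).subtype)}

variable {B M : Type*} [NormedAddCommGroup B] [NormedSpace ℝ B] [TopologicalSpace M]
  [ChartedSpace B M]

/-- `D` is transverse to `q : N → M`: its spaces are complementary to the kernels of `T q`. -/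
def IsTransverse {k : ℕ} (D : TangentDistribution V N k) (q : N → M) : Prop :=
  ∀ x, IsCompl (D.space x) (mfderiv 𝓘(ℝ, V) 𝓘(ℝ, B) q x).ker

/-- `γ` is an integral section of `D` over `U`: the tangent spaces of its image are the spaces of
`D`. -/
def IsIntegralSectionOn {k : ℕ} (D : TangentDistribution V N k) (U : Set M) (γ : M → N) : Prop :=
  ∀ x ∈ U, (mfderiv 𝓘(ℝ, B) 𝓘(ℝ, V) γ x).range = D.space (γ x)

/-- The distributions `D` and `D'` are `f`-related: every multivector field of the class of `D'` is
`f`-related to some multivector field of the class of `D`, and conversely, where `X'` and `X` are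
`f`-related if `X' ∘ f = Λ^k T f ∘ X`. -/
def IsRelated {k : ℕ} [IsManifold 𝓘(ℝ, B) ∞ M] (f : N → M) (D : TangentDistribution V N k)
    (D' : TangentDistribution B M k) : Prop :=
  (∀ X' ∈ D'.multivectorClass, ∃ X ∈ D.multivectorClass, ∀ x,
    X' (f x) = exteriorPower.map k (mfderiv 𝓘(ℝ, V) 𝓘(ℝ, B) f x).toLinearMap (X x)) ∧
  (∀ X ∈ D.multivectorClass, ∃ X' ∈ D'.multivectorClass, ∀ x,
    X' (f x) = exteriorPower.map k (mfderiv 𝓘(ℝ, V) 𝓘(ℝ, B) f x).toLinearMap (X x))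

end TangentDistribution

end Manifolds

section LocalSection

variable {B V M N : Type*} [NormedAddCommGroup B] [NormedSpace ℝ B] [NormedAddCommGroup V]
  [NormedSpace ℝ V] [TopologicalSpace M] [ChartedSpace B M] [TopologicalSpace N] [ChartedSpace V N]

/-- `γ` is a smooth local section of `q : N → M` on the open set `U` (the values of `γ` outside
`U` are irrelevant). -/
structure IsLocalSection (q : N → M) (U : Set M) (γ : M → N) : Prop where
  isOpen : IsOpen U
  contMDiffOn : ContMDiffOn 𝓘(ℝ, B) 𝓘(ℝ, V) ∞ γ U
  proj_apply : ∀ x ∈ U, q (γ x) = x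

end LocalSection

/-! ### The Lagrangian formalism -/

section Lagrangian

variable {B EE F : Type*}
  [NormedAddCommGroup B] [NormedSpace ℝ B] [FiniteDimensional ℝ B]
  [NormedAddCommGroup EE] [NormedSpace ℝ EE] [FiniteDimensional ℝ EE]
  [NormedAddCommGroup F] [NormedSpace ℝ F]
  {M E S : Type*}
  [TopologicalSpace M] [ChartedSpace B M] [IsManifold 𝓘(ℝ, B) ∞ M]
  [TopologicalSpace E] [ChartedSpace EE E] [IsManifold 𝓘(ℝ, EE) ∞ E]
  [TopologicalSpace S] [ChartedSpace F S] [IsManifold 𝓘(ℝ, F) ∞ S]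
  {p : SmoothFiberBundle B EE F M E S}

instance (x : M) : FiniteDimensional ℝ (TangentSpace 𝓘(ℝ, B) x) :=
  inferInstanceAs (FiniteDimensional ℝ B)

instance (x : M) : T2Space (TangentSpace 𝓘(ℝ, B) x) := inferInstanceAs (T2Space B)

namespace Jet

/-- The projection of the jet bundle onto the base `M`. -/
def base (j : Jet p) : M := p.proj j.pt

/-- `j` is the `1`-jet of `φ` at its base point. -/
def IsJetOf (j : Jet p) (φ : M → E) : Prop :=
  ∀ v : TangentSpace 𝓘(ℝ, B) (p.proj j.pt),
    tangentMap 𝓘(ℝ, B) 𝓘(ℝ, EE) φ ⟨p.proj j.pt, v⟩ = ⟨j.pt, j.lin v⟩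

variable (p) in
/-- `T_x^*M ⊗ V_u π`, with `x = π u`: the linear maps from `T_x M` to the vertical space at `u`. -/
def vertHom (u : E) :
    Submodule ℝ (TangentSpace 𝓘(ℝ, B) (p.proj u) →L[ℝ] TangentSpace 𝓘(ℝ, EE) u) where
  carrier := {A | (mfderiv 𝓘(ℝ, EE) 𝓘(ℝ, B) p.proj u).comp A = 0}
  add_mem' {A A'} hA hA' := by
    ext v
    have h := DFunLike.congr_fun hA v
    have h' := DFunLike.congr_fun hA' v
    simp_all
  zero_mem' := by ext v; simp
  smul_mem' a A hA := by
    ext v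
    have h := DFunLike.congr_fun hA v
    simp_all

/-- The translate `j + A` in the fibre of the jet bundle over `E`, which is an affine space
modelled on `T_x^*M ⊗ V_u π`. -/
def translate (j : Jet p) (A : vertHom p j.pt) : Jet p where
  pt := j.pt
  lin := j.lin + A.1
  proj_lin := by
    have h : (mfderiv 𝓘(ℝ, EE) 𝓘(ℝ, B) p.proj j.pt).comp A.1 = 0 := A.2
    rw [ContinuousLinearMap.comp_add, h, add_zero, j.proj_lin]

/-- The rank one element `α ⊗ (v - T φ (T π v))` of `T_x^*M ⊗ V_u π`, where `j` is the jet of `φ`;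
the map `v ↦ v - T φ (T π v)` is the vertical differential. -/
def rankOne (j : Jet p) (α : TangentSpace 𝓘(ℝ, B) (p.proj j.pt) →L[ℝ] ℝ)
    (v : TangentSpace 𝓘(ℝ, EE) j.pt) : vertHom p j.pt :=
  ⟨α.smulRight (v - j.lin (mfderiv 𝓘(ℝ, EE) 𝓘(ℝ, B) p.proj j.pt v)), by
    ext w
    have h := DFunLike.congr_fun j.proj_lin (mfderiv 𝓘(ℝ, EE) 𝓘(ℝ, B) p.proj j.pt v)
    simp only [ContinuousLinearMap.comp_apply, ContinuousLinearMap.id_apply] at h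
    simp [h]⟩

end Jet

/-- The derivative of the Lagrangian function `L` at `j` along the fibre of the jet bundle over
`E`; in coordinates `A ↦ (∂L/∂u_i^α) A_i^α`. -/
def fiberDeriv (L : Jet p → ℝ) (j : Jet p) : Jet.vertHom p j.pt →L[ℝ] ℝ :=
  fderiv ℝ (fun A => L (j.translate A)) 0

/-- The Hessian of `L` at `j` along the fibre of the jet bundle over `E`; in coordinates
`∂²L/∂u_i^α∂u_j^β`. -/
def fiberHessian (L : Jet p → ℝ) (j : Jet p) :
    Jet.vertHom p j.pt →L[ℝ] Jet.vertHom p j.pt →L[ℝ] ℝ :=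
  fderiv ℝ (fderiv ℝ fun A => L (j.translate A)) 0

/-- The Lagrangian is regular: its Hessian along the fibres of the jet bundle over `E` is
nondegenerate at every point. -/
def IsRegularLagrangian (L : Jet p → ℝ) : Prop :=
  ∀ j, ∀ A : Jet.vertHom p j.pt, (∀ A', fiberHessian L j A A' = 0) → A = 0

/-- The bilinear map `(α, v) ↦ (∂L/∂u_i^α) (α ⊗ (v - T φ (T π v)))_i^α`. -/
def fiberDerivBilin (L : Jet p → ℝ) (j : Jet p) :
    (TangentSpace 𝓘(ℝ, B) (p.proj j.pt) →L[ℝ] ℝ) →ₗ[ℝ] TangentSpace 𝓘(ℝ, EE) j.pt →ₗ[ℝ] ℝ :=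
  LinearMap.mk₂ ℝ (fun α v => fiberDeriv L j (j.rankOne α v))
    (fun α α' v => by
      rw [← map_add]; congr 1; ext w; simp [Jet.rankOne, add_smul])
    (fun a α v => by
      rw [← map_smul]; congr 1; ext w; simp [Jet.rankOne, mul_smul])
    (fun α v v' => by
      rw [← map_add]; congr 1; ext w; simp [Jet.rankOne, add_sub_add_comm])
    (fun a α v => by
      rw [← map_smul]; congr 1; ext w; simp [Jet.rankOne, smul_sub, smul_comm a])

variable {m : ℕ}

/-- The Cartan `m`-form of the Lagrangian density `L η`,
`Θ_L = (∂L/∂u_i^α) (du^α - u_j^α dx^j) ∧ i(∂/∂x^i) η + L η`, as a form on `J¹π`. It is evaluated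
on tangent vectors through their projections `v₁, …, v_m` to `E`:
`L η(T π v₁, …, T π v_m)` plus the sum over `k` of the fibre derivative of `L` applied to
`(w ↦ η(T π v₁, …, w, …, T π v_m)) ⊗ (v_k - T φ (T π v_k))`. -/
def cartanForm (η : ∀ x : M, TangentSpace 𝓘(ℝ, B) x [⋀^Fin m]→L[ℝ] ℝ) (L : Jet p → ℝ)
    (j : Jet p) : TangentSpace 𝓘(ℝ, (B × F) × (B →L[ℝ] F)) j [⋀^Fin m]→L[ℝ] ℝ :=
  (L j • (η (p.proj j.pt)).compContinuousLinearMap (mfderiv 𝓘(ℝ, EE) 𝓘(ℝ, B) p.proj j.pt) +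
    alternatingMapToContinuous (slotSum (η (p.proj j.pt))
      (mfderiv 𝓘(ℝ, EE) 𝓘(ℝ, B) p.proj j.pt) (fiberDerivBilin L j))).compContinuousLinearMap
    (mfderiv 𝓘(ℝ, (B × F) × (B →L[ℝ] F)) 𝓘(ℝ, EE) (Jet.pt : Jet p → E) j)

/-- The Cartan `(m+1)`-form `Ω_L = -dΘ_L`. -/
def cartanFormSucc (η : ∀ x : M, TangentSpace 𝓘(ℝ, B) x [⋀^Fin m]→L[ℝ] ℝ) (L : Jet p → ℝ)
    (j : Jet p) : TangentSpace 𝓘(ℝ, (B × F) × (B →L[ℝ] F)) j [⋀^Fin (m + 1)]→L[ℝ] ℝ :=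
  -formExtDeriv (cartanForm η L) j

/-- The field equation for a section `ψ` of `J¹π` over `U`: `ψ^* i(X) Ω_L = 0` for every smooth
vector field `X` on `J¹π`. -/
def SatisfiesFieldEquation (η : ∀ x : M, TangentSpace 𝓘(ℝ, B) x [⋀^Fin m]→L[ℝ] ℝ)
    (L : Jet p → ℝ) (U : Set M) (ψ : M → Jet p) : Prop :=
  ∀ X : (∀ j : Jet p, TangentSpace 𝓘(ℝ, (B × F) × (B →L[ℝ] F)) j),
    IsSmoothVectorFieldOn X univ → ∀ x ∈ U, ∀ v : Fin m → TangentSpace 𝓘(ℝ, B) x,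
      cartanFormSucc η L (ψ x) (Matrix.vecCons (X (ψ x)) fun i =>
        mfderiv 𝓘(ℝ, B) 𝓘(ℝ, (B × F) × (B →L[ℝ] F)) ψ x (v i)) = 0

/-- `D` is a solution of the Lagrangian problem: a distribution on `J¹π` that is transverse to the
base, integrable, and whose integral sections are prolongations `j¹φ` of sections `φ` of `π`
satisfying the field equation. -/
structure IsLagrangianDistribution (η : ∀ x : M, TangentSpace 𝓘(ℝ, B) x [⋀^Fin m]→L[ℝ] ℝ)
    (L : Jet p → ℝ) (D : TangentDistribution ((B × F) × (B →L[ℝ] F)) (Jet p) m) : Prop where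
  transverse : D.IsTransverse (B := B) (Jet.base : Jet p → M)
  integrable : D.IsIntegrable
  holonomic : ∀ (U : Set M) (ψ : M → Jet p),
    IsLocalSection (B := B) (V := (B × F) × (B →L[ℝ] F)) Jet.base U ψ →
    D.IsIntegralSectionOn (B := B) U ψ →
      ∃ φ : M → E, IsLocalSection (B := B) (V := EE) p.proj U φ ∧ (∀ x ∈ U, (ψ x).IsJetOf φ) ∧
        SatisfiesFieldEquation η L U ψ

/-! ### The generalized Hamilton–Jacobi problem -/

variable (p) in
/-- A jet field: a smooth section of `J¹π → E`. -/
structure JetField where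
  toFun : E → Jet p
  contMDiff : ContMDiff 𝓘(ℝ, EE) 𝓘(ℝ, (B × F) × (B →L[ℝ] F)) ∞ toFun
  pt_toFun : ∀ u, (toFun u).pt = u

/-- The condition of the generalized Lagrangian Hamilton–Jacobi problem: if `γ` is a (local)
section of `π` that is an integral section of `D`, then `Ψ ∘ γ` is an integral section of `DL`. -/
def SatisfiesHJCondition (Ψ : JetField p) (D : TangentDistribution EE E m)
    (DL : TangentDistribution ((B × F) × (B →L[ℝ] F)) (Jet p) m) : Prop :=
  ∀ (U : Set M) (γ : M → E), IsLocalSection (B := B) (V := EE) p.proj U γ →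
    D.IsIntegralSectionOn (B := B) U γ → DL.IsIntegralSectionOn (B := B) U (Ψ.toFun ∘ γ)

end Lagrangian

end ClassicalFieldTheory

end

open ClassicalFieldTheory

namespace ClassicalFieldTheory

/-! ### Decomposable multivectors -/

section ExteriorPower

variable {V W : Type*} [AddCommGroup V] [Module ℝ V] [AddCommGroup W] [Module ℝ W] {k : ℕ}

/-! Both conditions are equivalent to the pointwise identity `TΨ(D_u) = (DL)_{Ψ(u)}` for all `u` in
`E`.

For the Hamilton–Jacobi condition (`satisfiesHJCondition_iff`): if `γ` is an integral section of
`D`, the chain rule gives `TΨ(D_{γ(x)})` as the tangent space of `Im(Ψ ∘ γ)`. Integral sections pass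
through every point of `E`, because `D` is integrable and transverse: an integral manifold is
locally a graph over `M`, by the inverse function theorem.

From the identity to relatedness (`isRelated_of_map_eq`): `Tπ¹` inverts `TΨ` on `DL` along `Im Ψ`,
so a multivector field of `DL` is pulled back by `Λ^m Tπ¹`. Conversely, a multivector field of `D`
pushed forward by `Ψ` is defined only on `Im Ψ`. It is extended to all of `J¹π` by projecting it to
`M` and taking the horizontal lift to the transverse distribution `DL`.

From relatedness to the identity (`map_eq_of_isRelated`): a nonzero decomposable `m`-vector
determines its `m`-dimensional subspace, so a single related pair suffices. Such a pair exists only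
if the class of `DL` is nonempty. The volume form ensures this: its dual multivector field on `M`
lifts to `DL`. -/

theorem ιMulti_ne_zero {v : Fin k → V} (hv : LinearIndependent ℝ v) :
    exteriorPower.ιMulti ℝ k v ≠ 0 := by
  have hf : Function.Injective (Fintype.linearCombination ℝ v) :=
    hv.fintypeLinearCombination_injective
  -- The determinant factors through `ιMulti` and equals `1` on the standard basis. Injective linear
  -- maps then preserve nonvanishing, since they induce injective maps on exterior powers over a
  -- field.
  have h1 : exteriorPower.ιMulti ℝ k (Pi.basisFun ℝ (Fin k)) ≠ 0 := fun h => by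
    have h2 := exteriorPower.alternatingMapLinearEquiv_apply_ιMulti
      (Pi.basisFun ℝ (Fin k)).det (Pi.basisFun ℝ (Fin k))
    rw [h, map_zero, Module.Basis.det_self] at h2
    exact zero_ne_one h2
  have h3 : exteriorPower.map k (Fintype.linearCombination ℝ v)
      (exteriorPower.ιMulti ℝ k (Pi.basisFun ℝ (Fin k))) = exteriorPower.ιMulti ℝ k v := by
    rw [exteriorPower.map_apply_ιMulti]
    congr 1
    ext i
    simp [Fintype.linearCombination_apply_single]
  rw [← h3]
  exact fun h => h1 (exteriorPower.map_injective_field hf (h.trans (map_zero _).symm))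

/-- A vector outside the span would extend `v` to an independent family, whose wedge is nonzero.
This is how a subspace is recovered from its decomposable multivector. -/
theorem mem_span_of_ιMulti_cons_eq_zero {v : Fin k → V} (hv : LinearIndependent ℝ v) {w : V}
    (h : exteriorPower.ιMulti ℝ (k + 1) (Fin.cons w v) = 0) :
    w ∈ Submodule.span ℝ (range v) := by
  by_contra hw
  exact ιMulti_ne_zero (linearIndependent_finCons.2 ⟨hv, hw⟩) h

/-- A top degree alternating map is determined by its value on a basis. -/
theorem alternatingMap_apply_eq_det_smul (b : Module.Basis (Fin k) ℝ V) (f : V [⋀^Fin k]→ₗ[ℝ] W)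
    (v : Fin k → V) : f v = b.det v • f b := by
  have h : f = (LinearMap.toSpanSingleton ℝ W (f b)).compAlternatingMap b.det := by
    -- It suffices to compare on injective families of basis vectors. In top degree these are
    -- permutations of `b`, and both sides change by the same sign.
    refine Module.Basis.ext_alternating b fun σ hσ => ?_
    have h1 : (fun i => b (σ i)) = b ∘ Equiv.ofBijective σ (Finite.injective_iff_bijective.1 hσ) :=
      rfl
    rw [h1, AlternatingMap.map_perm, AlternatingMap.map_perm]
    simp [LinearMap.toSpanSingleton, b.det_self]
  conv_lhs => rw [h]
  simp [LinearMap.toSpanSingleton]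

/-- The top exterior power of `P` is a line: decomposable elements span it, and each is a
determinant times the wedge of the basis. -/
theorem exists_eq_smul_ιMulti {P : Submodule ℝ V} {b : Fin k → V} (hb : LinearIndependent ℝ b)
    (hP : Submodule.span ℝ (range b) = P) {ξ : ⋀[ℝ]^k V}
    (hξ : ξ ∈ LinearMap.range (exteriorPower.map k P.subtype)) :
    ∃ c : ℝ, ξ = c • exteriorPower.ιMulti ℝ k b := by
  subst hP
  obtain ⟨ζ, rfl⟩ := hξ
  let e := Module.Basis.span hb
  have hζ : ζ ∈ Submodule.span ℝ (range (exteriorPower.ιMulti ℝ k)) := by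
    rw [exteriorPower.ιMulti_span]; trivial
  induction hζ using Submodule.span_induction with
  | mem x hx =>
    obtain ⟨v, rfl⟩ := hx
    refine ⟨e.det v, ?_⟩
    rw [alternatingMap_apply_eq_det_smul e, map_smul, exteriorPower.map_apply_ιMulti]
    congr 2
    ext i
    simp [e, Module.Basis.span_apply]
  | zero => exact ⟨0, by simp⟩
  | add x y _ _ hx hy =>
    obtain ⟨a, ha⟩ := hx
    obtain ⟨c, hc⟩ := hy
    exact ⟨a + c, by rw [map_add, ha, hc, add_smul]⟩
  | smul a x _ hx =>
    obtain ⟨c, hc⟩ := hx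
    exact ⟨a * c, by rw [map_smul, hc, mul_smul]⟩

theorem ιMulti_mem_range_map_subtype {P : Submodule ℝ V} {v : Fin k → V} (hv : ∀ i, v i ∈ P) :
    exteriorPower.ιMulti ℝ k v ∈ LinearMap.range (exteriorPower.map k P.subtype) :=
  ⟨exteriorPower.ιMulti ℝ k fun i => ⟨v i, hv i⟩, by
    rw [exteriorPower.map_apply_ιMulti]; rfl⟩

theorem map_mem_range_map_subtype {P : Submodule ℝ V} {Q : Submodule ℝ W} {f : V →ₗ[ℝ] W}
    (hf : ∀ v ∈ P, f v ∈ Q) {ξ : ⋀[ℝ]^k V}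
    (hξ : ξ ∈ LinearMap.range (exteriorPower.map k P.subtype)) :
    exteriorPower.map k f ξ ∈ LinearMap.range (exteriorPower.map k Q.subtype) := by
  obtain ⟨ζ, rfl⟩ := hξ
  refine ⟨exteriorPower.map k (f.restrict hf) ζ, ?_⟩
  rw [← LinearMap.comp_apply, ← LinearMap.comp_apply, ← exteriorPower.map_comp,
    ← exteriorPower.map_comp]
  rfl

/-- The restriction of `f` to `P` is injective, hence so is its exterior power. Applied to a
transverse distribution, it identifies `k`-vectors by their projections to the base. -/
theorem map_injOn_range_map_subtype {P : Submodule ℝ V} {f : V →ₗ[ℝ] W}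
    (hf : Disjoint P (LinearMap.ker f)) {ξ ξ' : ⋀[ℝ]^k V}
    (hξ : ξ ∈ LinearMap.range (exteriorPower.map k P.subtype))
    (hξ' : ξ' ∈ LinearMap.range (exteriorPower.map k P.subtype))
    (h : exteriorPower.map k f ξ = exteriorPower.map k f ξ') : ξ = ξ' := by
  obtain ⟨ζ, rfl⟩ := hξ
  obtain ⟨ζ', rfl⟩ := hξ'
  simp only [← LinearMap.comp_apply, ← exteriorPower.map_comp] at h
  refine congrArg _ (exteriorPower.map_injective_field ?_ h)
  rw [← LinearMap.domRestrict, LinearMap.injective_domRestrict_iff]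
  exact hf

/-- If a linear map sends a `k`-vector of a `k`-dimensional space `P` to a nonzero `k`-vector of a
`k`-dimensional space `Q`, it maps `P` onto `Q`. -/
theorem map_eq_of_exteriorPower_map_mem {P : Submodule ℝ V} {Q : Submodule ℝ W} {b : Fin k → V}
    (hb : LinearIndependent ℝ b) (hP : Submodule.span ℝ (range b) = P) {d : Fin k → W}
    (hd : LinearIndependent ℝ d) (hQ : Submodule.span ℝ (range d) = Q) {f : V →ₗ[ℝ] W}
    {ξ : ⋀[ℝ]^k V} (hξ : ξ ∈ LinearMap.range (exteriorPower.map k P.subtype))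
    (h0 : exteriorPower.map k f ξ ≠ 0)
    (hfξ : exteriorPower.map k f ξ ∈ LinearMap.range (exteriorPower.map k Q.subtype)) :
    P.map f = Q := by
  obtain ⟨a, ha⟩ := exists_eq_smul_ιMulti hb hP hξ
  obtain ⟨c, hc⟩ := exists_eq_smul_ιMulti hd hQ hfξ
  rw [ha, map_smul, exteriorPower.map_apply_ιMulti] at h0 hc
  have hc0 : c ≠ 0 := by
    rintro rfl
    rw [zero_smul] at hc
    exact h0 hc
  have hfb : LinearIndependent ℝ (f ∘ b) := by
    by_contra hn
    rw [AlternatingMap.map_linearDependent _ _ hn, smul_zero] at h0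
    exact h0 rfl
  have hmem : ∀ i, f (b i) ∈ Q := fun i => by
    rw [← hQ]
    refine mem_span_of_ιMulti_cons_eq_zero hd ?_
    -- Wedging `hc` with `f (b i)` kills the left side, where that factor is repeated. As `c ≠ 0`,
    -- the wedge of `f (b i)` with `d` vanishes.
    have h1 := congrArg (fun z : ⋀[ℝ]^k W => ExteriorAlgebra.ι ℝ (f (b i)) * (z : ExteriorAlgebra ℝ W)) hc
    have h2 : ∀ v : Fin k → W, ExteriorAlgebra.ι ℝ (f (b i)) * ExteriorAlgebra.ιMulti ℝ k v =
        ExteriorAlgebra.ιMulti ℝ (k + 1) (Fin.cons (f (b i)) v) := fun v => by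
      rw [ExteriorAlgebra.ιMulti_succ_apply]
      simp [Matrix.vecTail, Function.comp_def]
    simp only [Submodule.coe_smul, exteriorPower.ιMulti_apply_coe, mul_smul_comm, h2] at h1
    rw [AlternatingMap.map_eq_zero_of_eq _ _ (i := 0) (j := i.succ) (by simp)
      (Fin.succ_ne_zero i).symm, smul_zero] at h1
    ext
    simpa [hc0] using h1.symm
  have hle : P.map f ≤ Q := by
    rw [← hP, Submodule.map_span, Submodule.span_le]
    rintro _ ⟨_, ⟨i, rfl⟩, rfl⟩
    exact hmem i
  have hfin : FiniteDimensional ℝ Q := by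
    rw [← hQ]
    exact FiniteDimensional.span_of_finite ℝ (finite_range _)
  refine Submodule.eq_of_le_of_finrank_eq hle ?_
  rw [← hP, ← hQ, Submodule.map_span, ← range_comp, finrank_span_eq_card hfb,
    finrank_span_eq_card hd]

end ExteriorPower

/-! ### Horizontal lifts to a transverse distribution -/

section HorizontalLift

variable {V N B M : Type*} [NormedAddCommGroup V] [NormedSpace ℝ V] [TopologicalSpace N]
  [ChartedSpace V N] [IsManifold 𝓘(ℝ, V) ∞ N] [NormedAddCommGroup B] [NormedSpace ℝ B]
  [TopologicalSpace M] [ChartedSpace B M]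
  {k : ℕ}

namespace TangentDistribution

theorem exists_basis (D : TangentDistribution V N k) (x : N) :
    ∃ b : Fin k → TangentSpace 𝓘(ℝ, V) x, LinearIndependent ℝ b ∧
      Submodule.span ℝ (range b) = D.space x := by
  obtain ⟨U, -, hx, X, -, hX⟩ := D.exists_frame x
  exact ⟨fun i => X i x, hX x hx⟩

theorem finrank_space (D : TangentDistribution V N k) (x : N) :
    Module.finrank ℝ (D.space x) = k := by
  obtain ⟨b, hb, hD⟩ := D.exists_basis x
  rw [← hD, finrank_span_eq_card hb, Fintype.card_fin]

theorem finiteDimensional_space (D : TangentDistribution V N k) (x : N) :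
    FiniteDimensional ℝ (D.space x) := by
  obtain ⟨b, -, hD⟩ := D.exists_basis x
  rw [← hD]
  exact FiniteDimensional.span_of_finite ℝ (finite_range _)

theorem IsTransverse.injOn {D : TangentDistribution V N k} {q : N → M}
    (h : D.IsTransverse (B := B) q) {x : N} {v w : TangentSpace 𝓘(ℝ, V) x} (hv : v ∈ D.space x)
    (hw : w ∈ D.space x)
    (hvw : mfderiv 𝓘(ℝ, V) 𝓘(ℝ, B) q x v = mfderiv 𝓘(ℝ, V) 𝓘(ℝ, B) q x w) : v = w := by
  rw [← sub_eq_zero]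
  refine Submodule.disjoint_def.1 (h x).disjoint _ (Submodule.sub_mem _ hv hw) ?_
  rw [LinearMap.mem_ker]
  exact (map_sub (mfderiv 𝓘(ℝ, V) 𝓘(ℝ, B) q x) v w).trans (sub_eq_zero.2 hvw)

variable [FiniteDimensional ℝ B]

/-- Tangent vectors of the base lift uniquely to a distribution which is transverse to a
map to a manifold of the same dimension. -/
theorem IsTransverse.exists_lift {D : TangentDistribution V N k} {q : N → M}
    (h : D.IsTransverse (B := B) q) (hk : Module.finrank ℝ B = k) (x : N) :
    ∃ l : TangentSpace 𝓘(ℝ, B) (q x) →ₗ[ℝ] TangentSpace 𝓘(ℝ, V) x,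
      ∀ w, l w ∈ D.space x ∧ mfderiv 𝓘(ℝ, V) 𝓘(ℝ, B) q x (l w) = w := by
  have := D.finiteDimensional_space x
  let f : D.space x →ₗ[ℝ] TangentSpace 𝓘(ℝ, B) (q x) :=
    (mfderiv 𝓘(ℝ, V) 𝓘(ℝ, B) q x).toLinearMap.domRestrict (D.space x)
  have hf : Function.Injective f := fun v w hvw => Subtype.ext (h.injOn v.2 w.2 hvw)
  have hd : Module.finrank ℝ (D.space x) = Module.finrank ℝ (TangentSpace 𝓘(ℝ, B) (q x)) :=
    (D.finrank_space x).trans hk.symm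
  let e := LinearEquiv.ofInjectiveOfFinrankEq f hf hd
  refine ⟨(D.space x).subtype ∘ₗ e.symm.toLinearMap, fun w => ⟨(e.symm w).2, ?_⟩⟩
  exact e.apply_symm_apply w

variable [IsManifold 𝓘(ℝ, B) ∞ M]

/-- The lift to a transverse distribution of a smooth vector field along a map is smooth. -/
theorem IsTransverse.isSmoothVectorFieldOn_lift {D : TangentDistribution V N k} {q : N → M}
    (h : D.IsTransverse (B := B) q) (hq : ContMDiff 𝓘(ℝ, V) 𝓘(ℝ, B) ∞ q)
    (hk : Module.finrank ℝ B = k) {U : Set N} (hU : IsOpen U)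
    {W : ∀ x : N, TangentSpace 𝓘(ℝ, B) (q x)}
    (hW : ContMDiffOn 𝓘(ℝ, V) 𝓘(ℝ, B).tangent ∞
      (fun x => (⟨q x, W x⟩ : TangentBundle 𝓘(ℝ, B) M)) U)
    {Y : ∀ x : N, TangentSpace 𝓘(ℝ, V) x} (hY : ∀ x, Y x ∈ D.space x)
    (hYW : ∀ x, mfderiv 𝓘(ℝ, V) 𝓘(ℝ, B) q x (Y x) = W x) : IsSmoothVectorFieldOn Y U := by
  intro x₀ hx₀
  refine ContMDiffAt.contMDiffWithinAt ?_
  obtain ⟨U', hU', hx₀', X, hX, hXD⟩ := D.exists_frame x₀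
  have hXat : ∀ i, ContMDiffAt 𝓘(ℝ, V) 𝓘(ℝ, V).tangent ∞
      (fun x => (⟨x, X i x⟩ : TangentBundle 𝓘(ℝ, V) N)) x₀ := fun i =>
    (hX i).contMDiffAt (hU'.mem_nhds hx₀')
  -- No regularity of `Y` is assumed. Its coefficients in the frame `X` solve a linear system over
  -- the trivialization `T`, whose matrix `A` is smooth and invertible near `x₀`; smoothness of
  -- inversion gives that of the coefficients.
  let T := trivializationAt B (TangentSpace 𝓘(ℝ, B) : M → Type _) (q x₀)
  let ℓ : ∀ x : N, TangentSpace 𝓘(ℝ, B) (q x) →L[ℝ] B := fun x => T.continuousLinearMapAt ℝ (q x)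
  have hbase : ∀ᶠ x in nhds x₀, q x ∈ T.baseSet :=
    hq.continuous.continuousAt.eventually
      (T.open_baseSet.mem_nhds (FiberBundle.mem_baseSet_trivializationAt' (q x₀)))
  have hℓ : ∀ᶠ x in nhds x₀, ∀ w : TangentSpace 𝓘(ℝ, B) (q x), (T ⟨q x, w⟩).2 = ℓ x w := by
    filter_upwards [hbase] with x hx w
    simp [ℓ, T.coe_linearMapAt_of_mem hx]
  have hℓinj : ∀ᶠ x in nhds x₀, Function.Injective (ℓ x) := by
    filter_upwards [hbase, hℓ] with x hx hx' v w hvw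
    rw [← hx', ← hx'] at hvw
    exact (T.continuousLinearEquivAt ℝ (q x) hx).injective hvw
  -- smoothness of the coordinate expressions
  have hw : ContMDiffAt 𝓘(ℝ, V) 𝓘(ℝ, B) ∞ (fun x => ℓ x (W x)) x₀ := by
    have := (Bundle.contMDiffAt_totalSpace.1 (hW.contMDiffAt (hU.mem_nhds hx₀))).2
    refine this.congr_of_eventuallyEq ?_
    filter_upwards [hℓ] with x hx using (hx _).symm
  have ha : ∀ i, ContMDiffAt 𝓘(ℝ, V) 𝓘(ℝ, B) ∞
      (fun x => ℓ x (mfderiv 𝓘(ℝ, V) 𝓘(ℝ, B) q x (X i x))) x₀ := fun i => by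
    have h1 : ContMDiffAt 𝓘(ℝ, V) 𝓘(ℝ, B).tangent ∞ (fun x => tangentMap 𝓘(ℝ, V) 𝓘(ℝ, B) q
        (⟨x, X i x⟩ : TangentBundle 𝓘(ℝ, V) N)) x₀ :=
      ((hq.contMDiff_tangentMap (m := ∞) (by simp)).contMDiffAt).comp x₀ (hXat i)
    have := (Bundle.contMDiffAt_totalSpace.1 h1).2
    refine this.congr_of_eventuallyEq ?_
    filter_upwards [hℓ] with x hx using (hx _).symm
  let A : N → (Fin k → ℝ) →L[ℝ] B := fun x =>
    ∑ i, ContinuousLinearMap.smulRightL ℝ (Fin k → ℝ) B (ContinuousLinearMap.proj i)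
      (ℓ x (mfderiv 𝓘(ℝ, V) 𝓘(ℝ, B) q x (X i x)))
  have hA : ∀ x c, A x c = ℓ x (mfderiv 𝓘(ℝ, V) 𝓘(ℝ, B) q x (∑ i, c i • X i x)) := fun x c => by
    simp [A]
  have hAs : ContMDiffAt 𝓘(ℝ, V) 𝓘(ℝ, (Fin k → ℝ) →L[ℝ] B) ∞ A x₀ := by
    refine contMDiffAt_finsetSum fun i _ => ?_
    exact (ContinuousLinearMap.contMDiff _).contMDiffAt.comp x₀ (ha i)
  have hinv : ∀ᶠ x in nhds x₀, (A x).IsInvertible := by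
    filter_upwards [hℓinj, hU'.mem_nhds hx₀'] with x hx hxU
    have hinj : Function.Injective (A x).toLinearMap := fun c d hcd => by
      have h1 : ℓ x (mfderiv 𝓘(ℝ, V) 𝓘(ℝ, B) q x (∑ i, c i • X i x)) =
          ℓ x (mfderiv 𝓘(ℝ, V) 𝓘(ℝ, B) q x (∑ i, d i • X i x)) := by
        rw [← hA, ← hA]; exact hcd
      have hmem : ∀ c : Fin k → ℝ, ∑ i, c i • X i x ∈ D.space x := fun c => by
        rw [← (hXD x hxU).2]
        exact Submodule.sum_mem _ fun i _ =>
          Submodule.smul_mem _ _ (Submodule.subset_span (mem_range_self i))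
      exact (hXD x hxU).1.fintypeLinearCombination_injective (h.injOn (hmem c) (hmem d) (hx h1))
    exact ⟨(LinearEquiv.ofInjectiveOfFinrankEq _ hinj (by simp [hk])).toContinuousLinearEquiv, rfl⟩
  have hc : ContMDiffAt 𝓘(ℝ, V) 𝓘(ℝ, Fin k → ℝ) ∞ (fun x => (A x).inverse (ℓ x (W x))) x₀ := by
    have h1 : ContMDiffAt 𝓘(ℝ, V) 𝓘(ℝ, B →L[ℝ] (Fin k → ℝ)) ∞ (fun x => (A x).inverse) x₀ :=
      (hinv.self_of_nhds.contDiffAt_map_inverse.contMDiffAt).comp x₀ hAs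
    exact h1.clm_apply hw
  have hsum : ContMDiffAt 𝓘(ℝ, V) 𝓘(ℝ, V).tangent ∞
      (fun x => (⟨x, ∑ i, (A x).inverse (ℓ x (W x)) i • X i x⟩ : TangentBundle 𝓘(ℝ, V) N)) x₀ := by
    refine ContMDiffAt.sum_section fun i _ => ContMDiffAt.smul_section ?_ (hXat i)
    exact (contMDiffAt_pi_space.1 hc) i
  refine hsum.congr_of_eventuallyEq ?_
  -- `Y` and the constructed combination both lie in `D` and have the same projection, so
  -- transversality makes them equal.
  filter_upwards [hinv, hℓinj, hU'.mem_nhds hx₀'] with x hx hx' hxU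
  congr 1
  refine h.injOn (hY x) ?_ (hx' ?_)
  · rw [← (hXD x hxU).2]
    exact Submodule.sum_mem _ fun i _ =>
      Submodule.smul_mem _ _ (Submodule.subset_span (mem_range_self i))
  · rw [hYW, ← hA, hx.self_apply_inverse]

/-- A nowhere vanishing, locally decomposable multivector field of top degree along `q` lifts to
every distribution of that dimension which is transverse to `q`. -/
theorem IsTransverse.exists_lift_multivector {D : TangentDistribution V N k} {q : N → M}
    (h : D.IsTransverse (B := B) q) (hq : ContMDiff 𝓘(ℝ, V) 𝓘(ℝ, B) ∞ q)
    (hk : Module.finrank ℝ B = k) (W : ∀ x : N, ⋀[ℝ]^k (TangentSpace 𝓘(ℝ, B) (q x)))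
    (hW0 : ∀ x, W x ≠ 0)
    (hW : ∀ x₀ : N, ∃ U : Set N, IsOpen U ∧ x₀ ∈ U ∧
      ∃ Y : Fin k → ∀ x : N, TangentSpace 𝓘(ℝ, B) (q x),
        (∀ i, ContMDiffOn 𝓘(ℝ, V) 𝓘(ℝ, B).tangent ∞
          (fun x => (⟨q x, Y i x⟩ : TangentBundle 𝓘(ℝ, B) M)) U) ∧
        ∀ x ∈ U, W x = exteriorPower.ιMulti ℝ k fun i => Y i x) :
    ∃ X ∈ D.multivectorClass, ∀ x,
      exteriorPower.map k (mfderiv 𝓘(ℝ, V) 𝓘(ℝ, B) q x).toLinearMap (X x) = W x := by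
  -- The choice is pointwise; smoothness of the lifted fields follows from uniqueness of lifts,
  -- through `isSmoothVectorFieldOn_lift`.
  choose l hl using h.exists_lift hk
  have hcomp : ∀ x, exteriorPower.map k (mfderiv 𝓘(ℝ, V) 𝓘(ℝ, B) q x).toLinearMap
      (exteriorPower.map k (l x) (W x)) = W x := fun x => by
    rw [← LinearMap.comp_apply, ← exteriorPower.map_comp]
    have h1 : (mfderiv 𝓘(ℝ, V) 𝓘(ℝ, B) q x).toLinearMap ∘ₗ l x = LinearMap.id :=
      LinearMap.ext fun w => (hl x w).2
    rw [h1, exteriorPower.map_id, LinearMap.id_apply]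
  refine ⟨fun x => exteriorPower.map k (l x) (W x), ⟨fun x h0 => hW0 x ?_, fun x₀ => ?_,
    fun x => ?_⟩, hcomp⟩
  · exact (hcomp x).symm.trans ((congrArg _ h0).trans (map_zero _))
  · obtain ⟨U, hU, hx₀, Y, hY, hWY⟩ := hW x₀
    refine ⟨U, hU, hx₀, fun i x => l x (Y i x), fun i => ?_, fun x hx => ?_⟩
    · exact h.isSmoothVectorFieldOn_lift hq hk hU (hY i) (fun x => (hl x _).1) fun x => (hl x _).2
    · change exteriorPower.map k (l x) (W x) = _
      rw [hWY x hx, exteriorPower.map_apply_ιMulti]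
      rfl
  · refine map_mem_range_map_subtype (P := ⊤) (fun v _ => (hl x v).1) ?_
    have : Function.Surjective (⊤ : Submodule ℝ (TangentSpace 𝓘(ℝ, B) (q x))).subtype :=
      fun v => ⟨⟨v, trivial⟩, rfl⟩
    exact exteriorPower.map_surjective this (W x)

end TangentDistribution

end HorizontalLift

/-! ### Integral sections of integrable transverse distributions -/

section IntegralSection

variable {V N B M : Type*} [NormedAddCommGroup V] [NormedSpace ℝ V] [TopologicalSpace N]
  [ChartedSpace V N] [NormedAddCommGroup B] [NormedSpace ℝ B] [TopologicalSpace M]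
  [ChartedSpace B M] {k : ℕ}

/-- The tangent map of a local section, composed with the tangent map of the projection, is the
identity. -/
theorem IsLocalSection.mfderiv_proj_mfderiv {q : N → M} (hq : ContMDiff 𝓘(ℝ, V) 𝓘(ℝ, B) ∞ q)
    {U : Set M} {γ : M → N} (hγ : IsLocalSection (B := B) (V := V) q U γ) {x : M} (hx : x ∈ U)
    (v : TangentSpace 𝓘(ℝ, B) x) :
    mfderiv 𝓘(ℝ, V) 𝓘(ℝ, B) q (γ x) (mfderiv 𝓘(ℝ, B) 𝓘(ℝ, V) γ x v) = v := by
  have h1 : HasMFDerivAt 𝓘(ℝ, B) 𝓘(ℝ, B) (q ∘ γ) x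
      ((mfderiv 𝓘(ℝ, V) 𝓘(ℝ, B) q (γ x)).comp (mfderiv 𝓘(ℝ, B) 𝓘(ℝ, V) γ x)) :=
    HasMFDerivAt.comp x (hq.mdifferentiable (by simp) _).hasMFDerivAt
      ((hγ.contMDiffOn.contMDiffAt (hγ.isOpen.mem_nhds hx)).mdifferentiableAt
        (by simp)).hasMFDerivAt
  have h2 : q ∘ γ =ᶠ[nhds x] id :=
    Filter.eventuallyEq_of_mem (hγ.isOpen.mem_nhds hx) hγ.proj_apply
  have h3 := hasMFDerivAt_unique h1 ((hasMFDerivAt_id x).congr_of_eventuallyEq h2)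
  exact DFunLike.congr_fun h3 v

variable [IsManifold 𝓘(ℝ, V) ∞ N] [FiniteDimensional ℝ B] [IsManifold 𝓘(ℝ, B) ∞ M]

/-- Through every point passes an integral section of an integrable transverse distribution. -/
theorem TangentDistribution.IsIntegrable.exists_integralSection {D : TangentDistribution V N k}
    (hD : D.IsIntegrable) {q : N → M} (hq : ContMDiff 𝓘(ℝ, V) 𝓘(ℝ, B) ∞ q)
    (htr : D.IsTransverse (B := B) q) (hk : Module.finrank ℝ B = k) (u : N) :
    ∃ (U : Set M) (γ : M → N), IsLocalSection (B := B) (V := V) q U γ ∧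
      D.IsIntegralSectionOn (B := B) U γ ∧ ∃ x ∈ U, γ x = u := by
  obtain ⟨U, f, hU, h0, rfl, hf, hfD⟩ := hD u
  let c := chartAt B (q (f 0))
  have hc := contMDiffOn_chart (I := 𝓘(ℝ, B)) (n := ∞) (x := q (f 0))
  -- The integral manifold `f` read in a chart of the base. Transversality makes `g` a local
  -- diffeomorphism, and the section is `f ∘ g⁻¹ ∘ c`.
  let g : EuclideanSpace ℝ (Fin k) → B := fun t => c (q (f t))
  let U₁ := U ∩ (fun t => q (f t)) ⁻¹' c.source
  have hqf : ContMDiffOn 𝓘(ℝ, EuclideanSpace ℝ (Fin k)) 𝓘(ℝ, B) ∞ (fun t => q (f t)) U :=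
    hq.comp_contMDiffOn hf
  have hU₁ : IsOpen U₁ := hqf.continuousOn.isOpen_inter_preimage hU c.open_source
  have h0₁ : (0 : EuclideanSpace ℝ (Fin k)) ∈ U₁ := ⟨h0, mem_chart_source B _⟩
  have hg : ContMDiffOn 𝓘(ℝ, EuclideanSpace ℝ (Fin k)) 𝓘(ℝ, B) ∞ g U₁ :=
    hc.comp (hqf.mono inter_subset_left) fun t ht => ht.2
  have hgat : ∀ t ∈ U₁, ContDiffAt ℝ ∞ g t := fun t ht =>
    (contMDiffOn_iff_contDiffOn.1 hg).contDiffAt (hU₁.mem_nhds ht)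
  -- Invertibility is needed on all of `U₁`, not only at `0`, so that the local inverse is smooth on
  -- an open set.
  have hgd : ∀ t ∈ U₁, ∃ g' : EuclideanSpace ℝ (Fin k) ≃L[ℝ] B,
      HasFDerivAt g (g' : EuclideanSpace ℝ (Fin k) →L[ℝ] B) t := fun t ht => by
    have h1 : HasMFDerivAt 𝓘(ℝ, EuclideanSpace ℝ (Fin k)) 𝓘(ℝ, B) g t
        ((mfderiv 𝓘(ℝ, B) 𝓘(ℝ, B) c (q (f t))).comp
          ((mfderiv 𝓘(ℝ, V) 𝓘(ℝ, B) q (f t)).comp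
            (mfderiv 𝓘(ℝ, EuclideanSpace ℝ (Fin k)) 𝓘(ℝ, V) f t))) := by
      refine HasMFDerivAt.comp t ?_ (HasMFDerivAt.comp t
        (hq.mdifferentiable (by simp) _).hasMFDerivAt ?_)
      · exact ((hc.contMDiffAt (c.open_source.mem_nhds ht.2)).mdifferentiableAt
          (by simp)).hasMFDerivAt
      · exact ((hf.contMDiffAt (hU.mem_nhds ht.1)).mdifferentiableAt (by simp)).hasMFDerivAt
    have hcinj : Function.Injective (mfderiv 𝓘(ℝ, B) 𝓘(ℝ, B) c (q (f t))) :=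
      ((mdifferentiable_chart (I := 𝓘(ℝ, B)) (q (f 0))).mfderiv ht.2).injective
    have hmem : ∀ v, mfderiv 𝓘(ℝ, EuclideanSpace ℝ (Fin k)) 𝓘(ℝ, V) f t v ∈ D.space (f t) :=
      fun v => by
        rw [← (hfD t ht.1).2]
        exact ⟨v, rfl⟩
    have hinj : Function.Injective (mfderiv 𝓘(ℝ, EuclideanSpace ℝ (Fin k)) 𝓘(ℝ, B) g t) := by
      rw [h1.mfderiv]
      exact fun v w hvw => (hfD t ht.1).1 (htr.injOn (hmem v) (hmem w) (hcinj hvw))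
    have hinj' : Function.Injective (fderiv ℝ g t).toLinearMap := by
      rw [mfderiv_eq_fderiv] at hinj
      exact hinj
    refine ⟨(LinearEquiv.ofInjectiveOfFinrankEq _ hinj' (by simp [hk])).toContinuousLinearEquiv, ?_⟩
    exact ((hgat t ht).differentiableAt (by simp)).hasFDerivAt
  obtain ⟨g', hg'⟩ := hgd 0 h0₁
  let H := (hgat 0 h0₁).toOpenPartialHomeomorph g hg' (by simp)
  let O := H.target ∩ H.symm ⁻¹' U₁
  have hO : IsOpen O := H.isOpen_inter_preimage_symm hU₁
  have hHs : ContDiffOn ℝ ∞ H.symm O := fun y hy => by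
    obtain ⟨e, he⟩ := hgd _ hy.2
    exact (H.contDiffAt_symm hy.1 he (hgat _ hy.2)).contDiffWithinAt
  let U₂ := c.source ∩ c ⁻¹' O
  have hU₂ : IsOpen U₂ := c.isOpen_inter_preimage hO
  have hτ : ContMDiffOn 𝓘(ℝ, B) 𝓘(ℝ, EuclideanSpace ℝ (Fin k)) ∞ (fun x => H.symm (c x)) U₂ :=
    hHs.contMDiffOn.comp (hc.mono inter_subset_left) fun x hx => hx.2
  have hγ : IsLocalSection (B := B) (V := V) q U₂ fun x => f (H.symm (c x)) := by
    refine ⟨hU₂, hf.comp hτ fun x hx => hx.2.2.1, fun x hx => ?_⟩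
    exact c.injOn hx.2.2.2 hx.1 (H.right_inv hx.2.1)
  have h0H : (0 : EuclideanSpace ℝ (Fin k)) ∈ H.source :=
    (hgat 0 h0₁).mem_toOpenPartialHomeomorph_source hg' (by simp)
  have h0s : H.symm (c (q (f 0))) = 0 := H.left_inv h0H
  refine ⟨U₂, _, hγ, fun x hx => ?_, q (f 0), ⟨mem_chart_source B _, H.map_source h0H, ?_⟩,
    congrArg f h0s⟩
  -- The chain rule gives only an inclusion into `D`; equality follows by dimension, a section
  -- having injective tangent map.
  · have hle : (mfderiv 𝓘(ℝ, B) 𝓘(ℝ, V) (fun x => f (H.symm (c x))) x).range ≤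
        D.space (f (H.symm (c x))) := by
      have h1 : HasMFDerivAt 𝓘(ℝ, B) 𝓘(ℝ, V) (fun x => f (H.symm (c x))) x _ :=
        HasMFDerivAt.comp x ((hf.contMDiffAt (hU.mem_nhds hx.2.2.1)).mdifferentiableAt
          (by simp)).hasMFDerivAt ((hτ.contMDiffAt (hU₂.mem_nhds hx)).mdifferentiableAt
          (by simp)).hasMFDerivAt
      rw [h1.mfderiv, ← (hfD _ hx.2.2.1).2]
      rintro _ ⟨v, rfl⟩
      exact ⟨_, rfl⟩
    have := D.finiteDimensional_space (f (H.symm (c x)))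
    refine Submodule.eq_of_le_of_finrank_eq hle ?_
    rw [D.finrank_space]
    refine (LinearMap.finrank_range_of_inj (f := (mfderiv 𝓘(ℝ, B) 𝓘(ℝ, V)
      (fun x => f (H.symm (c x))) x).toLinearMap) ?_).trans hk
    exact Function.LeftInverse.injective fun v => hγ.mfderiv_proj_mfderiv hq hx v
  · change H.symm (c (q (f 0))) ∈ U₁
    rw [h0s]
    exact h0₁

end IntegralSection

/-! ### The multivector field of a volume form -/

section VolumeForm

variable {B M : Type*} [NormedAddCommGroup B] [NormedSpace ℝ B]
  [TopologicalSpace M] [ChartedSpace B M] [IsManifold 𝓘(ℝ, B) ∞ M] {m : ℕ}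

/-- Local vector fields of a frame around a point, on which a smooth form takes smooth values. -/
theorem IsSmoothForm.exists_frame {η : ∀ x : M, TangentSpace 𝓘(ℝ, B) x [⋀^Fin m]→L[ℝ] ℝ}
    (hη : IsSmoothForm η) (b : Module.Basis (Fin m) ℝ B) (x₀ : M) :
    ∃ U : Set M, IsOpen U ∧ x₀ ∈ U ∧ ∃ Y : Fin m → ∀ x : M, TangentSpace 𝓘(ℝ, B) x,
      (∀ i, IsSmoothVectorFieldOn (Y i) U) ∧ (∀ x ∈ U, LinearIndependent ℝ fun i => Y i x) ∧
      ContMDiffOn 𝓘(ℝ, B) 𝓘(ℝ, ℝ) ∞ (fun x => η x fun i => Y i x) U := by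
  let T := trivializationAt B (TangentSpace 𝓘(ℝ, B) : M → Type _) x₀
  refine ⟨T.baseSet, T.open_baseSet, FiberBundle.mem_baseSet_trivializationAt' x₀,
    T.localFrame b, T.contMDiffOn_localFrame_baseSet ∞ b,
    fun x hx => (T.isLocalFrameOn_localFrame_baseSet 𝓘(ℝ, B) ∞ b).linearIndependent hx, ?_⟩
  have h1 : ContMDiffOn 𝓘(ℝ, B) 𝓘(ℝ, ℝ) ∞
      (fun x => formInChart η x₀ (chartAt B x₀ x) fun i => b i) (chartAt B x₀).source := by
    have h2 : ContDiffOn ℝ ∞ (fun y => formInChart η x₀ y fun i => b i) (chartAt B x₀).target :=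
      (ContinuousAlternatingMap.apply ℝ B ℝ fun i => b i).contDiff.comp_contDiffOn (hη x₀)
    exact h2.contMDiffOn.comp contMDiffOn_chart fun x hx => (chartAt B x₀).map_source hx
  refine h1.congr fun x hx => ?_
  have h3 : ∀ i, T.localFrame b i x =
      mfderiv 𝓘(ℝ, B) 𝓘(ℝ, B) (chartAt B x₀).symm (chartAt B x₀ x) (b i) := fun i => by
    have h4 := DFunLike.congr_fun (TangentBundle.symmL_trivializationAt (I := 𝓘(ℝ, B)) hx) (b i)
    rw [T.localFrame_apply_of_mem_baseSet b hx]
    have h6 : T.basisAt b hx i = T.symmL ℝ x (b i) := by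
      simp only [Bundle.Trivialization.basisAt, Module.Basis.map_apply]
      exact (T.symmL_apply hx (b i)).symm
    rw [ModelWithCorners.range_eq_univ, mfderivWithin_univ] at h4
    exact h6.trans h4
  -- All tangent spaces are definitionally `B`; forgetting the dependence on the point lets
  -- `left_inv` be rewritten.
  let η' : M → B [⋀^Fin m]→L[ℝ] ℝ := η
  have h5 : η' ((chartAt B x₀).symm (chartAt B x₀ x)) = η' x := by
    rw [(chartAt B x₀).left_inv hx]
  refine Eq.trans ?_ (DFunLike.congr_fun h5 fun i =>
    mfderiv 𝓘(ℝ, B) 𝓘(ℝ, B) (chartAt B x₀).symm (chartAt B x₀ x) (b i)).symm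
  exact congrArg (η' x) (funext h3)

variable [FiniteDimensional ℝ B]

/-- On a manifold with a volume form there is a nowhere vanishing, locally decomposable multivector
field of top degree. -/
theorem IsVolumeForm.exists_multivector
    {η : ∀ x : M, TangentSpace 𝓘(ℝ, B) x [⋀^Fin m]→L[ℝ] ℝ} (hη : IsVolumeForm η)
    (hm : Module.finrank ℝ B = m) :
    ∃ Z : ∀ x : M, ⋀[ℝ]^m (TangentSpace 𝓘(ℝ, B) x), (∀ x, Z x ≠ 0) ∧
      IsLocallyDecomposable Z := by
  let b : Module.Basis (Fin m) ℝ B := Module.finBasisOfFinrankEq ℝ B hm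
  let b' : ∀ x : M, Module.Basis (Fin m) ℝ (TangentSpace 𝓘(ℝ, B) x) := fun x => b
  -- An independent family of `m` vectors is a basis, and a top degree form vanishing on a basis is
  -- zero.
  have hne : ∀ x, ∀ v : Fin m → TangentSpace 𝓘(ℝ, B) x, LinearIndependent ℝ v → η x v ≠ 0 :=
    fun x v hv h => hη.ne_zero x <| by
      have hd : Fintype.card (Fin m) = Module.finrank ℝ (TangentSpace 𝓘(ℝ, B) x) := by
        rw [Fintype.card_fin]; exact hm.symm
      ext w
      have h1 := alternatingMap_apply_eq_det_smul
        (basisOfLinearIndependentOfCardEqFinrank' v hv hd) (η x).toAlternatingMap w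
      rw [coe_basisOfLinearIndependentOfCardEqFinrank'] at h1
      exact h1.trans (by erw [h]; simp)
  cases m with
  -- In degree `0` the only decomposable element is the empty wedge, and no vector field could
  -- absorb a factor `η⁻¹`.
  | zero =>
    refine ⟨fun x => exteriorPower.ιMulti ℝ 0 (b' x),
      fun x => ιMulti_ne_zero (b' x).linearIndependent, fun x₀ => ⟨univ, isOpen_univ, trivial,
      finZeroElim, fun i => i.elim0, fun x _ => ?_⟩⟩
    exact congrArg _ (Subsingleton.elim _ _)
  | succ m =>
    -- The multivector dual to `η`. Under a change of basis `η` and the wedge scale by the same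
    -- determinant, so `b'` may be replaced by a smooth local frame, although `b'` itself need not
    -- be smooth.
    refine ⟨fun x => (η x (b' x))⁻¹ • exteriorPower.ιMulti ℝ (m + 1) (b' x), fun x =>
      smul_ne_zero (inv_ne_zero (hne x _ (b' x).linearIndependent))
        (ιMulti_ne_zero (b' x).linearIndependent), fun x₀ => ?_⟩
    obtain ⟨U, hU, hx₀, Y, hY, hYi, hηY⟩ := hη.smooth.exists_frame b x₀
    -- The normalizing factor is put on the first vector field alone, so that it occurs once in the
    -- wedge.
    refine ⟨U, hU, hx₀, fun i x => (if i = 0 then (η x fun i => Y i x)⁻¹ else 1) • Y i x,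
      fun i => ?_, fun x hx => ?_⟩
    · refine ContMDiffOn.smul_section ?_ (hY i)
      by_cases hi : i = 0
      · simp only [hi, if_true]
        exact hηY.inv₀ fun x hx => hne x _ (hYi x hx)
      · simp only [hi, if_false]
        exact contMDiffOn_const
    · rw [← AlternatingMap.coe_multilinearMap, MultilinearMap.map_smul_univ,
        AlternatingMap.coe_multilinearMap, Fin.prod_univ_succ]
      simp only [if_true, Fin.succ_ne_zero, if_false, Finset.prod_const_one, mul_one]
      have h1 := alternatingMap_apply_eq_det_smul (b' x) (η x).toAlternatingMap fun i => Y i x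
      have h2 := alternatingMap_apply_eq_det_smul (b' x) (exteriorPower.ιMulti ℝ (m + 1))
        fun i => Y i x
      have h3 : (η x fun i => Y i x) = (b' x).det (fun i => Y i x) * η x (b' x) := h1
      have h4 := hne x _ (hYi x hx)
      rw [h3] at h4 ⊢
      rw [h2, smul_smul]
      congr 1
      have h5 := left_ne_zero_of_mul h4
      have h6 := right_ne_zero_of_mul h4
      field_simp

end VolumeForm

/-! ### The projections of the jet bundle -/

section Jet

variable {B EE F : Type*}
  [NormedAddCommGroup B] [NormedSpace ℝ B] [CompleteSpace B]
  [NormedAddCommGroup EE] [NormedSpace ℝ EE]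
  [NormedAddCommGroup F] [NormedSpace ℝ F]
  {M E S : Type*}
  [TopologicalSpace M] [ChartedSpace B M] [IsManifold 𝓘(ℝ, B) ∞ M]
  [TopologicalSpace E] [ChartedSpace EE E]
  [TopologicalSpace S] [ChartedSpace F S] [IsManifold 𝓘(ℝ, F) ∞ S]
  {p : SmoothFiberBundle B EE F M E S}

/-- In the induced charts the map is the projection to `(xⁱ, u^α)` followed by an inverse adapted
chart. -/
theorem Jet.contMDiff_pt :
    ContMDiff 𝓘(ℝ, (B × F) × (B →L[ℝ] F)) 𝓘(ℝ, EE) ∞ (Jet.pt : Jet p → E) := by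
  intro j
  -- This is the adapted chart chosen in `chartedSpaceCore`, so `hs` and `he` hold by definition.
  let c := (AdaptedChart.exists_mem p j.pt).choose
  let e := chartAt ((B × F) × (B →L[ℝ] F)) j
  have hs : ∀ j' ∈ e.source, j'.pt ∈ c.tot.source := fun j' hj' => hj'
  have he : ∀ j' ∈ e.source, (e j').1 = c.tot j'.pt := fun j' _ => rfl
  have h1 : ContMDiffOn 𝓘(ℝ, (B × F) × (B →L[ℝ] F)) 𝓘(ℝ, B × F) ∞ (fun j' => (e j').1) e.source :=
    contDiff_fst.contMDiff.comp_contMDiffOn contMDiffOn_chart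
  have h2 : ContMDiffOn 𝓘(ℝ, (B × F) × (B →L[ℝ] F)) 𝓘(ℝ, EE) ∞ (Jet.pt : Jet p → E) e.source := by
    refine (c.contMDiffOn_tot_symm.comp h1 fun j' hj' => ?_).congr fun j' hj' => ?_
    · exact c.tot.map_source (hs j' hj')
    · exact (c.tot.left_inv (hs j' hj')).symm
  exact h2.contMDiffAt (e.open_source.mem_nhds (mem_chart_source _ j))

end Jet

/-! ### Jet fields and related distributions -/

section HamiltonJacobi

variable {B EE F : Type*}
  [NormedAddCommGroup B] [NormedSpace ℝ B] [FiniteDimensional ℝ B]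
  [NormedAddCommGroup EE] [NormedSpace ℝ EE]
  [NormedAddCommGroup F] [NormedSpace ℝ F]
  {M E S : Type*}
  [TopologicalSpace M] [ChartedSpace B M] [IsManifold 𝓘(ℝ, B) ∞ M]
  [TopologicalSpace E] [ChartedSpace EE E]
  [TopologicalSpace S] [ChartedSpace F S] [IsManifold 𝓘(ℝ, F) ∞ S]
  {p : SmoothFiberBundle B EE F M E S} {m : ℕ}

theorem Jet.contMDiff_base :
    ContMDiff 𝓘(ℝ, (B × F) × (B →L[ℝ] F)) 𝓘(ℝ, B) ∞ (Jet.base : Jet p → M) :=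
  p.contMDiff_proj.comp Jet.contMDiff_pt

namespace JetField

variable (Ψ : JetField p)

theorem mdifferentiableAt (u : E) :
    MDifferentiableAt 𝓘(ℝ, EE) 𝓘(ℝ, (B × F) × (B →L[ℝ] F)) Ψ.toFun u :=
  Ψ.contMDiff.mdifferentiable (by simp) u

/-- The tangent map of a jet field. -/
noncomputable abbrev tangent (u : E) : TangentSpace 𝓘(ℝ, EE) u →ₗ[ℝ]
    TangentSpace 𝓘(ℝ, (B × F) × (B →L[ℝ] F)) (Ψ.toFun u) :=
  (mfderiv 𝓘(ℝ, EE) 𝓘(ℝ, (B × F) × (B →L[ℝ] F)) Ψ.toFun u).toLinearMap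

/-- Differentiation of `π¹ ∘ Ψ = id`; it supplies the left inverse of `TΨ`. -/
theorem mfderiv_pt_tangent (u : E) (v : TangentSpace 𝓘(ℝ, EE) u) :
    mfderiv 𝓘(ℝ, (B × F) × (B →L[ℝ] F)) 𝓘(ℝ, EE) Jet.pt (Ψ.toFun u) (Ψ.tangent u v) = v := by
  have h1 : HasMFDerivAt 𝓘(ℝ, EE) 𝓘(ℝ, EE) (Jet.pt ∘ Ψ.toFun) u _ :=
    HasMFDerivAt.comp u (Jet.contMDiff_pt.mdifferentiable (by simp) _).hasMFDerivAt
      (Ψ.mdifferentiableAt u).hasMFDerivAt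
  have h2 : Jet.pt ∘ Ψ.toFun = id := funext Ψ.pt_toFun
  exact DFunLike.congr_fun (hasMFDerivAt_unique h1 (h2 ▸ hasMFDerivAt_id u)) v

theorem mfderiv_base_tangent (u : E) (v : TangentSpace 𝓘(ℝ, EE) u) :
    mfderiv 𝓘(ℝ, (B × F) × (B →L[ℝ] F)) 𝓘(ℝ, B) Jet.base (Ψ.toFun u) (Ψ.tangent u v) =
      mfderiv 𝓘(ℝ, EE) 𝓘(ℝ, B) p.proj u v := by
  have h1 : HasMFDerivAt 𝓘(ℝ, EE) 𝓘(ℝ, B) (Jet.base ∘ Ψ.toFun) u _ :=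
    HasMFDerivAt.comp u (Jet.contMDiff_base.mdifferentiable (by simp) _).hasMFDerivAt
      (Ψ.mdifferentiableAt u).hasMFDerivAt
  have h2 : Jet.base ∘ Ψ.toFun = p.proj := funext fun u => congrArg p.proj (Ψ.pt_toFun u)
  have h3 : HasMFDerivAt 𝓘(ℝ, EE) 𝓘(ℝ, B) (Jet.base ∘ Ψ.toFun) u
      (mfderiv 𝓘(ℝ, EE) 𝓘(ℝ, B) p.proj u) :=
    h2 ▸ (p.contMDiff_proj.mdifferentiable (by simp) u).hasMFDerivAt
  exact DFunLike.congr_fun (hasMFDerivAt_unique h1 h3) v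

end JetField

variable [IsManifold 𝓘(ℝ, EE) ∞ E] {Ψ : JetField p} {D : TangentDistribution EE E m}
  {DL : TangentDistribution ((B × F) × (B →L[ℝ] F)) (Jet p) m}

/-- For an integrable transverse distribution `D`, the Hamilton–Jacobi condition says that `T Ψ`
maps `D` onto the distribution `DL`. -/
theorem satisfiesHJCondition_iff (hD : D.IsIntegrable) (htr : D.IsTransverse (B := B) p.proj)
    (hm : Module.finrank ℝ B = m) :
    SatisfiesHJCondition Ψ D DL ↔
      ∀ u, (D.space u).map (Ψ.tangent u) = DL.space (Ψ.toFun u) := by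
  have key : ∀ (U : Set M) (γ : M → E), IsLocalSection (B := B) (V := EE) p.proj U γ →
      D.IsIntegralSectionOn (B := B) U γ → ∀ x ∈ U,
      (mfderiv 𝓘(ℝ, B) 𝓘(ℝ, (B × F) × (B →L[ℝ] F)) (Ψ.toFun ∘ γ) x).range =
        (D.space (γ x)).map (Ψ.tangent (γ x)) := fun U γ hγ hγD x hx => by
    have h1 : HasMFDerivAt 𝓘(ℝ, B) 𝓘(ℝ, (B × F) × (B →L[ℝ] F)) (Ψ.toFun ∘ γ) x _ :=
      HasMFDerivAt.comp x (Ψ.mdifferentiableAt _).hasMFDerivAt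
        ((hγ.contMDiffOn.contMDiffAt (hγ.isOpen.mem_nhds hx)).mdifferentiableAt
          (by simp)).hasMFDerivAt
    rw [h1.mfderiv, ← hγD x hx]
    exact LinearMap.range_comp _ _
  refine ⟨fun h u => ?_, fun h U γ hγ hγD x hx => (key U γ hγ hγD x hx).trans (h _)⟩
  -- Without an integral section through `u`, the condition would say nothing at `u`.
  obtain ⟨U, γ, hγ, hγD, x, hx, rfl⟩ := hD.exists_integralSection p.contMDiff_proj htr hm u
  exact (key U γ hγ hγD x hx).symm.trans (h U γ hγ hγD x hx)

/-- A distribution on the jet bundle which is the image of a transverse distribution along a jet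
field is related to it. -/
theorem isRelated_of_map_eq (hDL : DL.IsTransverse (B := B) (Jet.base : Jet p → M))
    (htr : D.IsTransverse (B := B) p.proj) (hm : Module.finrank ℝ B = m)
    (h : ∀ u, (D.space u).map (Ψ.tangent u) = DL.space (Ψ.toFun u)) :
    TangentDistribution.IsRelated Ψ.toFun D DL := by
  have hmap : ∀ u, ∀ v ∈ D.space u, Ψ.tangent u v ∈ DL.space (Ψ.toFun u) := fun u v hv => by
    rw [← h u]
    exact Submodule.mem_map_of_mem hv
  let r : ∀ u : E, TangentSpace 𝓘(ℝ, (B × F) × (B →L[ℝ] F)) (Ψ.toFun u) →ₗ[ℝ]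
      TangentSpace 𝓘(ℝ, EE) u := fun u =>
    (mfderiv 𝓘(ℝ, (B × F) × (B →L[ℝ] F)) 𝓘(ℝ, EE) Jet.pt (Ψ.toFun u)).toLinearMap
  have hr : ∀ u v, r u (Ψ.tangent u v) = v := Ψ.mfderiv_pt_tangent
  have hrD : ∀ u, ∀ w ∈ DL.space (Ψ.toFun u), r u w ∈ D.space u ∧ Ψ.tangent u (r u w) = w :=
    fun u w hw => by
      rw [← h u] at hw
      obtain ⟨v, hv, rfl⟩ := hw
      rw [hr]
      exact ⟨hv, rfl⟩
  refine ⟨fun X' hX' => ?_, fun X hX => ?_⟩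
  · obtain ⟨hX'0, hX'd, hX'D⟩ := hX'
    -- On `DL` along `Im Ψ` the composite `TΨ ∘ r` is the identity, and `X'` takes values in `Λ^m
    -- DL`.
    have hX : ∀ u, X' (Ψ.toFun u) =
        exteriorPower.map m (Ψ.tangent u) (exteriorPower.map m (r u) (X' (Ψ.toFun u))) :=
      fun u => by
        obtain ⟨ζ, hζ⟩ := hX'D (Ψ.toFun u)
        rw [← hζ]
        simp only [← LinearMap.comp_apply, ← exteriorPower.map_comp]
        congr 2
        exact LinearMap.ext fun w => (hrD u w w.2).2.symm
    refine ⟨fun u => exteriorPower.map m (r u) (X' (Ψ.toFun u)), ⟨fun u h0 => ?_, fun u₀ => ?_,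
      fun u => ?_⟩, hX⟩
    · exact hX'0 (Ψ.toFun u) ((hX u).trans ((congrArg _ h0).trans (map_zero _)))
    · obtain ⟨U, hU, hu₀, Y, hY, hXY⟩ := hX'd (Ψ.toFun u₀)
      refine ⟨Ψ.toFun ⁻¹' U, hU.preimage Ψ.contMDiff.continuous, hu₀,
        fun i u => r u (Y i (Ψ.toFun u)), fun i => ?_, fun u hu => ?_⟩
      · have h1 : ContMDiffOn 𝓘(ℝ, EE) 𝓘(ℝ, EE).tangent ∞ (fun u =>
            tangentMap 𝓘(ℝ, (B × F) × (B →L[ℝ] F)) 𝓘(ℝ, EE) (Jet.pt : Jet p → E)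
              ⟨Ψ.toFun u, Y i (Ψ.toFun u)⟩) (Ψ.toFun ⁻¹' U) :=
          (Jet.contMDiff_pt.contMDiff_tangentMap (m := ∞) (by simp)).comp_contMDiffOn
            ((hY i).comp Ψ.contMDiff.contMDiffOn fun u hu => hu)
        refine h1.congr fun u _ => ?_
        -- The base points `(Ψ u).pt` and `u` are only propositionally equal.
        have h2 : ∀ (u' : E) (w : EE), u' = u → (⟨u, w⟩ : TangentBundle 𝓘(ℝ, EE) E) = ⟨u', w⟩ := by
          rintro _ w rfl
          rfl
        exact h2 _ _ (Ψ.pt_toFun u)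
      · change exteriorPower.map m (r u) (X' (Ψ.toFun u)) = _
        rw [hXY _ hu, exteriorPower.map_apply_ιMulti]
        rfl
    · exact map_mem_range_map_subtype (fun w hw => (hrD u w hw).1) (hX'D _)
  · obtain ⟨hX0, hXd, hXD⟩ := hX
    -- The field `X ∘ π¹`, projected to `M`, makes sense on all of `J¹π`; its lift to `DL` is the
    -- required extension off `Im Ψ`. It is nowhere zero because `D` is transverse.
    obtain ⟨X', hX', hbase⟩ := hDL.exists_lift_multivector Jet.contMDiff_base hm
      (fun j => exteriorPower.map m (mfderiv 𝓘(ℝ, EE) 𝓘(ℝ, B) p.proj j.pt).toLinearMap (X j.pt))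
      (fun j h0 => hX0 j.pt (map_injOn_range_map_subtype (htr _).disjoint (hXD _)
        (Submodule.zero_mem _) (h0.trans (map_zero _).symm)))
      (fun j₀ => by
        obtain ⟨U, hU, hu₀, Y, hY, hXY⟩ := hXd j₀.pt
        refine ⟨Jet.pt ⁻¹' U, hU.preimage Jet.contMDiff_pt.continuous, hu₀,
          fun i j => mfderiv 𝓘(ℝ, EE) 𝓘(ℝ, B) p.proj j.pt (Y i j.pt), fun i => ?_, fun j hj => ?_⟩
        · exact (p.contMDiff_proj.contMDiff_tangentMap (m := ∞) (by simp)).comp_contMDiffOn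
            ((hY i).comp Jet.contMDiff_pt.contMDiffOn fun j hj => hj)
        · rw [hXY _ hj, exteriorPower.map_apply_ιMulti]
          rfl)
    -- On `Im Ψ` both `m`-vectors lie in `Λ^m DL`, so comparing their projections to `M` is enough.
    refine ⟨X', hX', fun u => map_injOn_range_map_subtype (hDL _).disjoint (hX'.2.2 _)
      (map_mem_range_map_subtype (hmap u) (hXD u)) ?_⟩
    have h1 : ∀ u' : E, u' = u → (exteriorPower.map m
        (mfderiv 𝓘(ℝ, EE) 𝓘(ℝ, B) p.proj u').toLinearMap (X u') : ⋀[ℝ]^m B) =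
        exteriorPower.map m (mfderiv 𝓘(ℝ, EE) 𝓘(ℝ, B) p.proj u).toLinearMap (X u) := by
      rintro _ rfl
      rfl
    have h2 : (mfderiv 𝓘(ℝ, (B × F) × (B →L[ℝ] F)) 𝓘(ℝ, B) Jet.base (Ψ.toFun u)).toLinearMap ∘ₗ
        Ψ.tangent u = (mfderiv 𝓘(ℝ, EE) 𝓘(ℝ, B) p.proj u).toLinearMap :=
      LinearMap.ext (Ψ.mfderiv_base_tangent u)
    rw [← LinearMap.comp_apply, ← exteriorPower.map_comp, h2]
    exact (hbase (Ψ.toFun u)).trans (h1 _ (Ψ.pt_toFun u))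

/-- Over a base manifold with a volume form, a jet field along which two distributions are related
maps one onto the other. -/
theorem map_eq_of_isRelated {η : ∀ x : M, TangentSpace 𝓘(ℝ, B) x [⋀^Fin m]→L[ℝ] ℝ}
    (hη : IsVolumeForm η) (hDL : DL.IsTransverse (B := B) (Jet.base : Jet p → M))
    (hm : Module.finrank ℝ B = m) (h : TangentDistribution.IsRelated Ψ.toFun D DL) (u : E) :
    (D.space u).map (Ψ.tangent u) = DL.space (Ψ.toFun u) := by
  obtain ⟨Z, hZ0, hZ⟩ := hη.exists_multivector hm
  obtain ⟨X', hX', -⟩ := hDL.exists_lift_multivector Jet.contMDiff_base hm (fun j => Z j.base)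
    (fun j => hZ0 _) fun j₀ => by
      obtain ⟨U, hU, hx₀, Y, hY, hZY⟩ := hZ j₀.base
      exact ⟨Jet.base ⁻¹' U, hU.preimage Jet.contMDiff_base.continuous, hx₀,
        fun i j => Y i j.base,
        fun i => (hY i).comp Jet.contMDiff_base.contMDiffOn fun j hj => hj, fun j hj => hZY _ hj⟩
  -- Only this half of relatedness is needed: one nowhere vanishing pair determines the spaces at
  -- every point.
  obtain ⟨X, hX, hXX'⟩ := h.1 X' hX'
  obtain ⟨b, hb, hbD⟩ := D.exists_basis u
  obtain ⟨d, hd, hdD⟩ := DL.exists_basis (Ψ.toFun u)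
  have h1 : X' (Ψ.toFun u) = exteriorPower.map m (Ψ.tangent u) (X u) := hXX' u
  exact map_eq_of_exteriorPower_map_mem hb hbD hd hdD (hX.2.2 u) (h1 ▸ hX'.1 _) (h1 ▸ hX'.2.2 _)

end HamiltonJacobi

end ClassicalFieldTheory

theorem mainTheorem6 {m n : ℕ} {M E S : Type*}
    [TopologicalSpace M] [ChartedSpace (EuclideanSpace ℝ (Fin m)) M]
    [IsManifold 𝓘(ℝ, EuclideanSpace ℝ (Fin m)) ∞ M] [T2Space M] [SecondCountableTopology M]
    [TopologicalSpace E] [ChartedSpace (EuclideanSpace ℝ (Fin (m + n))) E]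
    [IsManifold 𝓘(ℝ, EuclideanSpace ℝ (Fin (m + n))) ∞ E] [T2Space E] [SecondCountableTopology E]
    [TopologicalSpace S] [ChartedSpace (EuclideanSpace ℝ (Fin n)) S]
    [IsManifold 𝓘(ℝ, EuclideanSpace ℝ (Fin n)) ∞ S]
    (p : SmoothFiberBundle (EuclideanSpace ℝ (Fin m)) (EuclideanSpace ℝ (Fin (m + n)))
      (EuclideanSpace ℝ (Fin n)) M E S)
    (η : ∀ x : M, TangentSpace 𝓘(ℝ, EuclideanSpace ℝ (Fin m)) x [⋀^Fin m]→L[ℝ] ℝ)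
    (hη : IsVolumeForm η)
    (L : Jet p → ℝ)
    (hL : ContMDiff 𝓘(ℝ, (EuclideanSpace ℝ (Fin m) × EuclideanSpace ℝ (Fin n)) ×
      (EuclideanSpace ℝ (Fin m) →L[ℝ] EuclideanSpace ℝ (Fin n))) 𝓘(ℝ, ℝ) ∞ L)
    (hreg : IsRegularLagrangian L)
    (DL : TangentDistribution ((EuclideanSpace ℝ (Fin m) × EuclideanSpace ℝ (Fin n)) ×
      (EuclideanSpace ℝ (Fin m) →L[ℝ] EuclideanSpace ℝ (Fin n))) (Jet p) m)
    (hDL : IsLagrangianDistribution η L DL)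
    (Ψ : JetField p)
    (D : TangentDistribution (EuclideanSpace ℝ (Fin (m + n))) E m)
    (hDint : D.IsIntegrable)
    (hDtr : D.IsTransverse (B := EuclideanSpace ℝ (Fin m)) p.proj) :
    SatisfiesHJCondition Ψ D DL ↔ TangentDistribution.IsRelated Ψ.toFun D DL := by
  have hm : Module.finrank ℝ (EuclideanSpace ℝ (Fin m)) = m := finrank_euclideanSpace_fin
  rw [satisfiesHJCondition_iff hDint hDtr hm]
  exact ⟨isRelated_of_map_eq hDL.transverse hDtr hm, map_eq_of_isRelated hη hDL.transverse hm⟩
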